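/- **Setting.** Fix a finite set of processes $\mathsf P=\{p_1,\dots,p_N\}$, a set $\mathsf{Var}$ of shared variables and a set $\mathsf{Val}$ of values with an initial value $0\in\mathsf{Val}$. A *memory event* is a pair $(p,a)$ of a process $p$ and an action $a$, which is a write $\mathtt W(x,v)$, a read $\mathtt R(x,v)$, a read-modify-write $\mathtt{RMW}(x,v_{\rm old},v_{\rm new})$ or a fence $\mathtt F$. A memory model is a labeled transition system (LTS) whose labels are memory events and a silent step $\tau$; its observable sequences are its traces with the $\tau$'s erased. The three models considered are: * $\mathrm{SCM}$: the states are maps $m:\mathsf{Var}\to\mathsf{Val}$, initially $0$; writes update $m$, $\mathtt R(x,v)$ requires $m(x)=v$, $\mathtt{RMW}(x,v_{\rm old},v_{\rm new})$ requires $m(x)=v_{\rm old}$ and sets $m(x):=v_{\rm new}$, and fences are no-ops. * $\mathrm{TSO}$: a memory $m$ (initially $0$) and a FIFO buffer of pairs $(x,v)$ for every process (initially empty). A write is appended to the buffer of its process; a $\tau$-step moves the oldest entry of some buffer to memory; a read of $x$ returns the latest value for $x$ in the buffer of the reading process or, if there is none, $m(x)$; an $\mathtt{RMW}$ or a fence of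 $p$ requires that the buffer of $p$ is empty, and an $\mathtt{RMW}$ acts on $m$ directly. * $\mathrm{RA}$: a set of messages $(x,v,t,V)$ (variable, value, timestamp $t\in\mathbb N$, view $V:\mathsf{Var}\to\mathbb N$), a view $V_p$ for every process and a fence view $V_{\mathsf f}$. Initially the messages are $(x,0,0,\lambda y.\,0)$ for $x\in\mathsf{Var}$, and all views are $0$. $\mathtt W(x,v)$ by $p$ picks a timestamp $t>V_p(x)$ not used by a message of $x$, sets $V_p(x):=t$ and adds $(x,v,t,V_p)$ with the updated $V_p$; $\mathtt R(x,v)$ requires a message $(x,v,V_p(x),\_)$; $\mathtt{RMW}(x,v_{\rm old},v_{\rm new})$ requires a message $(x,v_{\rm old},V_p(x),\_)$ and writes $v_{\rm new}$ with timestamp $V_p(x)+1$, which must be unused; a fence sets both $V_p$ and $V_{\mathsf f}$ to the pointwise maximum $V_p\sqcup V_{\mathsf f}$; a $\tau$-step picks a process $p$ and a message $(x,v,t,V)$ with $V_p(x)<t$ and sets $V_p:=V_p\sqcup V$. An *implementation* $\mathcal I$ of an object assigns to every operation $o$ and process $p$ an LTS $\mathcal I(o,p)$ whose labels are events of $p$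 (memory events, or invocation/response events of the object), with no transition enabled after a response. It induces an LTS in which every process repeatedly invokes an operation $o$, runs $\mathcal I(o,p)$ from its initial state, and responds, the processes being interleaved; $\mathrm{Tr}(\mathcal I)$ is the set of its traces. For a sequence $\pi$ of events, $\pi|_{\rm mem}$ and $\pi|_{\rm obj}$ are its restrictions to memory and to object events. $\mathcal I$ *generates* the history $h$ after $\pi_0$ under $M$ if $h=\pi|_{\rm obj}$ for some $\pi$ with $\pi_0\cdot\pi\in\mathrm{Tr}(\mathcal I)$ and $(\pi_0\cdot\pi)|_{\rm mem}$ an observable sequence of $M$. $\mathcal I$ is *consistent* under $M$ if every complete history that it generates under $M$ (after the empty sequence) can be reordered, preserving the order of the events of each process and the order of each response before each later invocation, to a history of the specification. $\mathcal I$ is *spec-available* if, for all complete sequential histories $h_0,h$ with $h_0\cdot h$ in the specification and every $\pi_0\in\mathrm{Tr}(\mathcal I)$ such that $\pi_0|_{\rm mem}$ is a trace of $\mathrm{SCM}$ and $\pi_0|_{\rm obj}=h_0$, $\mathcal I$ generates $h$ after $\pi_0$ under $\mathrm{SCM}$. $\mathsf{Counter}$ is the object with operations $\mathtt{inc},\mathtt{dec},\mathtt{read}$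 whose specification consists of the complete sequential histories in which $\mathtt{inc}$ and $\mathtt{dec}$ return $\mathtt{ack}$ and every $\mathtt{read}$ returns the number of preceding $\mathtt{inc}$'s minus the number of preceding $\mathtt{dec}$'s (an integer). A sequence $\sigma$ of memory events *is RBW* (read-before-write) if, whenever a write to $x$ precedes a read of some $y\ne x$, there is a write to $y$ strictly between them. It *is LTF* (leading-and-trailing-fence) if $\sigma=\sigma'\cdot\sigma''$, where no fence in $\sigma'$ immediately follows a non-fence, and no fence in $\sigma''$ is immediately followed by a non-fence. **Theorem.** Let $\mathcal I$ be a spec-available implementation of $\mathsf{Counter}$ that is consistent under $M\in\{\mathrm{SCM},\mathrm{TSO},\mathrm{RA}\}$. Assume $N\ge 2$ if $M\in\{\mathrm{SCM},\mathrm{TSO}\}$, and $N\ge 3$ if $M=\mathrm{RA}$. Then there exist $p,p'\in\mathsf P$, an operation $o\in\{\mathtt{inc},\mathtt{dec}\}$, a trace $\pi_1$ of $\mathcal I(o,p)$ and a trace $\pi_2$ of $\mathcal I(\mathtt{read},p')$ such that, for $\sigma_1=\pi_1|_{\rm mem}$ and $\sigma_2=\pi_2|_{\rm mem}$: (a) if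 $M=\mathrm{SCM}$, then $\sigma_1\cdot\sigma_2$ contains an RMW event or is not RBW; (b) if $M=\mathrm{TSO}$, then $\sigma_1\cdot\sigma_2$ contains an RMW event or is not LTF; (c) if $M=\mathrm{RA}$, then $\sigma_1$ or $\sigma_2$ contains an RMW event, or $\sigma_1$ or $\sigma_2$ is not LTF. -/

import Mathlib

namespace WeakMem

universe uP uVar uVal uOp uRet uL uS

/-! ### Labeled transition systems -/

/-- A labeled transition system with labels in `L`. -/
structure LTS (L : Type uL) where
  State : Type uS
  init : State
  Tr : State → L → State → Prop

namespace LTS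

variable {L : Type uL}

/-- `A.Steps q π q'`: there is an execution fragment from `q` to `q'` whose trace is `π`. -/
inductive Steps (A : LTS.{uL, uS} L) : A.State → List L → A.State → Prop
  | nil (q : A.State) : Steps A q [] q
  | cons {q q' q'' : A.State} {l : L} {π : List L} :
      A.Tr q l q' → Steps A q' π q'' → Steps A q (l :: π) q''

/-- Traces of `A` from the state `q`. -/
def tracesFrom (A : LTS.{uL, uS} L) (q : A.State) : Set (List L) :=
  {π | ∃ q', A.Steps q π q'}

/-- Traces of `A` (from its initial state). -/
def traces (A : LTS.{uL, uS} L) : Set (List L) := A.tracesFrom A.init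

end LTS

/-! ### Memory actions, memory events, memory models -/

/-- Memory actions: write, read, read-modify-write (variable, old value, new value), fence. -/
inductive MemAct (Var : Type uVar) (Val : Type uVal) : Type (max uVar uVal)
  | W (x : Var) (v : Val)
  | R (x : Var) (v : Val)
  | RMW (x : Var) (vold vnew : Val)
  | F

/-- A memory event: a process together with a memory action. -/
abbrev MemEvent (P : Type uP) (Var : Type uVar) (Val : Type uVal) := P × MemAct Var Val

/-- A memory model is an LTS whose labels are memory events (`some e`)
and the silent internal step `τ` (`none`). -/
abbrev MemoryModel (P : Type uP) (Var : Type uVar) (Val : Type uVal) :=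
  LTS.{max uP uVar uVal, uS} (Option (MemEvent P Var Val))

/-- Observable memory sequences of `M`: its traces with the silent steps erased. -/
def MemoryModel.otraces {P : Type uP} {Var : Type uVar} {Val : Type uVal}
    (M : MemoryModel.{uP, uVar, uVal, uS} P Var Val) : Set (List (MemEvent P Var Val)) :=
  {σ | ∃ ρ ∈ LTS.traces M, σ = ρ.reduceOption}

section Models

variable (P : Type uP) (Var : Type uVar) (Val : Type uVal)
variable [DecidableEq P] [DecidableEq Var] [Zero Val]

/-! #### Strictly consistent memory -/

variable {P Var Val} in
inductive SCM.Tr :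
    (Var → Val) → Option (MemEvent P Var Val) → (Var → Val) → Prop
  | write (m : Var → Val) (p : P) (x : Var) (v : Val) :
      SCM.Tr m (some (p, .W x v)) (Function.update m x v)
  | read (m : Var → Val) (p : P) (x : Var) :
      SCM.Tr m (some (p, .R x (m x))) m
  | rmw (m : Var → Val) (p : P) (x : Var) (vold vnew : Val) :
      m x = vold → SCM.Tr m (some (p, .RMW x vold vnew)) (Function.update m x vnew)
  | fence (m : Var → Val) (p : P) :
      SCM.Tr m (some (p, .F)) m

/-- The strictly consistent memory model; fences are no-ops. -/
def SCM : MemoryModel P Var Val where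
  State := Var → Val
  init := fun _ => 0
  Tr := SCM.Tr

/-! #### Total store order -/

/-- Main memory, and a FIFO store buffer for every process (oldest entry first). -/
structure TSO.St where
  mem : Var → Val
  buf : P → List (Var × Val)

variable {P Var Val} in
inductive TSO.Tr : TSO.St P Var Val → Option (MemEvent P Var Val) → TSO.St P Var Val → Prop
  | write (m : Var → Val) (b : P → List (Var × Val)) (p : P) (x : Var) (v : Val) :
      TSO.Tr ⟨m, b⟩ (some (p, .W x v)) ⟨m, Function.update b p (b p ++ [(x, v)])⟩
  | readFromBuffer (m : Var → Val) (b : P → List (Var × Val)) (p : P) (x : Var) (v : Val) :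
      ((b p).filter (fun w => w.1 = x)).getLast? = some (x, v) →
      TSO.Tr ⟨m, b⟩ (some (p, .R x v)) ⟨m, b⟩
  | readFromMemory (m : Var → Val) (b : P → List (Var × Val)) (p : P) (x : Var) (v : Val) :
      (b p).filter (fun w => w.1 = x) = [] → m x = v →
      TSO.Tr ⟨m, b⟩ (some (p, .R x v)) ⟨m, b⟩
  | rmw (m : Var → Val) (b : P → List (Var × Val)) (p : P) (x : Var) (vold vnew : Val) :
      b p = [] → m x = vold →
      TSO.Tr ⟨m, b⟩ (some (p, .RMW x vold vnew)) ⟨Function.update m x vnew, b⟩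
  | fence (m : Var → Val) (b : P → List (Var × Val)) (p : P) :
      b p = [] → TSO.Tr ⟨m, b⟩ (some (p, .F)) ⟨m, b⟩
  | propagate (m : Var → Val) (b : P → List (Var × Val)) (p : P) (x : Var) (v : Val)
      (β : List (Var × Val)) :
      b p = (x, v) :: β →
      TSO.Tr ⟨m, b⟩ none ⟨Function.update m x v, Function.update b p β⟩

/-- The total store order memory model. -/
def TSO : MemoryModel P Var Val where
  State := TSO.St P Var Val
  init := ⟨fun _ => 0, fun _ => []⟩
  Tr := TSO.Tr

/-! #### Release/acquire -/

/-- A message: variable, value, timestamp, view. -/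
structure RA.Msg where
  var : Var
  val : Val
  time : ℕ
  view : Var → ℕ

/-- The set of all messages so far, the view of every process, and the fence view. -/
structure RA.St where
  mem : Set (RA.Msg Var Val)
  pview : P → Var → ℕ
  fview : Var → ℕ

variable {P Var Val} in
/-- `t` is the timestamp of some message to `x` in `m`. -/
def RA.TimeUsed (m : Set (RA.Msg Var Val)) (x : Var) (t : ℕ) : Prop :=
  ∃ μ ∈ m, μ.var = x ∧ μ.time = t

variable {P Var Val} in
/-- `⊔` on views is the pointwise maximum. -/
inductive RA.Tr : RA.St P Var Val → Option (MemEvent P Var Val) → RA.St P Var Val → Prop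
  | write (m : Set (RA.Msg Var Val)) (pv : P → Var → ℕ) (fv : Var → ℕ)
      (p : P) (x : Var) (v : Val) (t : ℕ) (V' : Var → ℕ) :
      pv p x < t → ¬ RA.TimeUsed m x t → V' = Function.update (pv p) x t →
      RA.Tr ⟨m, pv, fv⟩ (some (p, .W x v))
        ⟨m ∪ {⟨x, v, t, V'⟩}, Function.update pv p V', fv⟩
  | read (m : Set (RA.Msg Var Val)) (pv : P → Var → ℕ) (fv : Var → ℕ)
      (p : P) (x : Var) (v : Val) (V : Var → ℕ) :
      (⟨x, v, pv p x, V⟩ : RA.Msg Var Val) ∈ m →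
      RA.Tr ⟨m, pv, fv⟩ (some (p, .R x v)) ⟨m, pv, fv⟩
  | rmw (m : Set (RA.Msg Var Val)) (pv : P → Var → ℕ) (fv : Var → ℕ)
      (p : P) (x : Var) (vold vnew : Val) (V : Var → ℕ) (t : ℕ) (V' : Var → ℕ) :
      (⟨x, vold, pv p x, V⟩ : RA.Msg Var Val) ∈ m → t = pv p x + 1 →
      ¬ RA.TimeUsed m x t → V' = Function.update (pv p) x t →
      RA.Tr ⟨m, pv, fv⟩ (some (p, .RMW x vold vnew))
        ⟨m ∪ {⟨x, vnew, t, V'⟩}, Function.update pv p V', fv⟩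
  | fence (m : Set (RA.Msg Var Val)) (pv : P → Var → ℕ) (fv : Var → ℕ)
      (p : P) (V' : Var → ℕ) :
      V' = pv p ⊔ fv →
      RA.Tr ⟨m, pv, fv⟩ (some (p, .F)) ⟨m, Function.update pv p V', V'⟩
  | propagate (m : Set (RA.Msg Var Val)) (pv : P → Var → ℕ) (fv : Var → ℕ)
      (p : P) (μ : RA.Msg Var Val) :
      μ ∈ m → pv p μ.var < μ.time →
      RA.Tr ⟨m, pv, fv⟩ none ⟨m, Function.update pv p (pv p ⊔ μ.view), fv⟩

/-- The release/acquire memory model. Initially there is one message to every variable, with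
the initial value `0`, timestamp `0` and the zero view. -/
def RA : MemoryModel P Var Val where
  State := RA.St P Var Val
  init := ⟨{μ | ∃ x : Var, μ = ⟨x, 0, 0, fun _ => 0⟩}, fun _ _ => 0, fun _ => 0⟩
  Tr := RA.Tr

end Models

/-! ### Restrictions on observable memory sequences -/

section Patterns

variable {P : Type uP} {Var : Type uVar} {Val : Type uVal}

/-- The event is a fence. -/
def IsFence (e : MemEvent P Var Val) : Prop := e.2 = .F

/-- Some event of the sequence is an RMW. -/
def HasRMW (σ : List (MemEvent P Var Val)) : Prop :=
  ∃ (p : P) (x : Var) (vold vnew : Val), (p, MemAct.RMW x vold vnew) ∈ σ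

/-- Read-before-write: between a write and a later read of a different variable
there is a write to the variable that is read. -/
def RBW (σ : List (MemEvent P Var Val)) : Prop :=
  ∀ (k₁ k₂ : ℕ) (p₁ p₂ : P) (x y : Var) (v w : Val), k₁ < k₂ →
    σ[k₁]? = some (p₁, .W x v) → σ[k₂]? = some (p₂, .R y w) → x ≠ y →
    ∃ (k : ℕ) (p : P) (u : Val), k₁ < k ∧ k < k₂ ∧ σ[k]? = some (p, .W y u)

/-- Trailing-fence: no fence is immediately followed by a non-fence. -/
def TF (σ : List (MemEvent P Var Val)) : Prop :=
  ¬ ∃ (k : ℕ) (e e' : MemEvent P Var Val),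
    σ[k]? = some e ∧ σ[k + 1]? = some e' ∧ IsFence e ∧ ¬ IsFence e'

/-- Leading-fence: no fence is immediately preceded by a non-fence. -/
def LF (σ : List (MemEvent P Var Val)) : Prop :=
  ¬ ∃ (k : ℕ) (e e' : MemEvent P Var Val),
    σ[k]? = some e ∧ σ[k + 1]? = some e' ∧ ¬ IsFence e ∧ IsFence e'

/-- Leading-and-trailing-fence. -/
def LTF (σ : List (MemEvent P Var Val)) : Prop :=
  ∃ σ₁ σ₂ : List (MemEvent P Var Val), σ = σ₁ ++ σ₂ ∧ LF σ₁ ∧ TF σ₂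

end Patterns

/-! ### Objects, histories, specifications -/

/-- Object actions: invocation of an operation, response with a value. -/
inductive ObjAct (Op : Type uOp) (Ret : Type uRet) : Type (max uOp uRet)
  | inv (o : Op)
  | res (u : Ret)

/-- An object event: a process together with an object action. -/
abbrev ObjEvent (P : Type uP) (Op : Type uOp) (Ret : Type uRet) := P × ObjAct Op Ret

section Histories

variable {P : Type uP} {Op : Type uOp} {Ret : Type uRet}

/-- The history of one operation `o` by process `p` with response value `u`. -/
def invres (p : P) (o : Op) (u : Ret) : List (ObjEvent P Op Ret) :=
  [(p, .inv o), (p, .res u)]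

/-- A history is sequential if it is a prefix of a concatenation of single operations. -/
def Sequential (h : List (ObjEvent P Op Ret)) : Prop :=
  ∃ l : List (P × Op × Ret), h <+: l.flatMap (fun c => invres c.1 c.2.1 c.2.2)

/-- The history is well-formed: every process behaves sequentially. -/
def WellFormed [DecidableEq P] (h : List (ObjEvent P Op Ret)) : Prop :=
  ∀ p : P, Sequential (h.filter (fun e => e.1 = p))

/-- A history is complete if it is well-formed and, for every process that occurs in it,
the last event of that process is a response. -/
def Complete [DecidableEq P] (h : List (ObjEvent P Op Ret)) : Prop :=
  WellFormed h ∧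
    ∀ (p : P) (e : ObjEvent P Op Ret),
      (h.filter (fun e => e.1 = p)).getLast? = some e → ∃ u : Ret, e.2 = .res u

/-- Complete sequential histories. -/
def CompleteSequential [DecidableEq P] (h : List (ObjEvent P Op Ret)) : Prop :=
  Complete h ∧ Sequential h

/-- `s'` is an `R`-reordering of `s`. -/
def IsReordering {X : Type*} (R : X → X → Prop) (s s' : List X) : Prop :=
  ∃ f : Fin s.length ≃ Fin s'.length,
    (∀ i, s.get i = s'.get (f i)) ∧
    ∀ i j, i < j → R (s.get i) (s.get j) → f i < f j

/-- The order that a linearization preserves: the order of the events of one process, and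
the order of a response before an invocation. -/
def lin (e₁ e₂ : ObjEvent P Op Ret) : Prop :=
  e₁.1 = e₂.1 ∨ ((∃ u : Ret, e₁.2 = .res u) ∧ ∃ o : Op, e₂.2 = .inv o)

/-- `h'` linearizes `h`. -/
def Linearizes (h h' : List (ObjEvent P Op Ret)) : Prop := IsReordering lin h h'

end Histories

/-- An object: operation names (arguments included), response values, and a prefix-closed
specification consisting of complete sequential histories. -/
structure Obj (P : Type uP) [DecidableEq P] where
  Op : Type uOp
  Ret : Type uRet
  Spec : Set (List (ObjEvent P Op Ret))
  spec_complete : ∀ h ∈ Spec, CompleteSequential h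
  spec_prefix : ∀ h ∈ Spec, ∀ h', CompleteSequential h' → h' <+: h → h' ∈ Spec

/-! ### Implementations -/

/-- Actions of a process: memory actions and object actions. -/
inductive Act (Var : Type uVar) (Val : Type uVal) (Op : Type uOp) (Ret : Type uRet) :
    Type (max uVar uVal uOp uRet)
  | mem (a : MemAct Var Val)
  | obj (a : ObjAct Op Ret)

/-- An event: a process together with a memory action or an object action. -/
abbrev Event (P : Type uP) (Var : Type uVar) (Val : Type uVal) (Op : Type uOp)
    (Ret : Type uRet) := P × Act Var Val Op Ret

section Restrict

variable {P : Type uP} {Var : Type uVar} {Val : Type uVal} {Op : Type uOp} {Ret : Type uRet}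

/-- The memory event underlying an event, if it is one. -/
def Event.mem? : Event P Var Val Op Ret → Option (MemEvent P Var Val)
  | (p, .mem a) => some (p, a)
  | (_, .obj _) => none

/-- The object event underlying an event, if it is one. -/
def Event.obj? : Event P Var Val Op Ret → Option (ObjEvent P Op Ret)
  | (_, .mem _) => none
  | (p, .obj a) => some (p, a)

/-- Restriction of a sequence of events to its memory events. -/
def restrictMem (π : List (Event P Var Val Op Ret)) : List (MemEvent P Var Val) :=
  π.filterMap Event.mem?

/-- Restriction of a sequence of events to its object events. -/
def restrictObj (π : List (Event P Var Val Op Ret)) : List (ObjEvent P Op Ret) :=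
  π.filterMap Event.obj?

end Restrict

/-- An implementation of one operation for process `p`: an LTS whose labels are events of `p`,
and in which no transition is enabled after a response. -/
structure OpImpl (P : Type uP) (Var : Type uVar) (Val : Type uVal) (Op : Type uOp)
    (Ret : Type uRet) (p : P) where
  lts : LTS.{max uP uVar uVal uOp uRet, uS} (Event P Var Val Op Ret)
  proc_eq : ∀ q e q', lts.Tr q e q' → e.1 = p
  res_last : ∀ q u q', lts.Tr q (p, .obj (.res u)) q' → ∀ e q'', ¬ lts.Tr q' e q''

/-- An implementation of an object: an implementation of every operation for every process. -/
abbrev Impl {P : Type uP} [DecidableEq P] (Var : Type uVar) (Val : Type uVal)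
    (O : Obj.{uP, uOp, uRet} P) :=
  ∀ (_ : O.Op) (p : P), OpImpl.{uP, uVar, uVal, uOp, uRet, uS} P Var Val O.Op O.Ret p

namespace Impl

variable {P : Type uP} [DecidableEq P] {Var : Type uVar} {Val : Type uVal}
variable {O : Obj.{uP, uOp, uRet} P}

/-- States of process `p`: `none` when no operation is being executed, and `some ⟨o, q⟩` when
`p` executes `o` and is in state `q` of the implementation of `o` for `p`. -/
abbrev ProcState (I : Impl.{uP, uVar, uVal, uOp, uRet, uS} Var Val O) (p : P) :=
  Option ((o : O.Op) × (I o p).lts.State)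

/-- Transitions of process `p`. -/
inductive ProcTr (I : Impl.{uP, uVar, uVal, uOp, uRet, uS} Var Val O) (p : P) :
    I.ProcState p → Event P Var Val O.Op O.Ret → I.ProcState p → Prop
  | invoke (o : O.Op) :
      ProcTr I p none (p, .obj (.inv o)) (some ⟨o, (I o p).lts.init⟩)
  | memory (o : O.Op) (q q' : (I o p).lts.State) (a : MemAct Var Val) :
      (I o p).lts.Tr q (p, .mem a) q' →
      ProcTr I p (some ⟨o, q⟩) (p, .mem a) (some ⟨o, q'⟩)
  | respond (o : O.Op) (q q' : (I o p).lts.State) (u : O.Ret) :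
      (I o p).lts.Tr q (p, .obj (.res u)) q' →
      ProcTr I p (some ⟨o, q⟩) (p, .obj (.res u)) none

/-- The LTS induced by an implementation: the interleaving of all processes. -/
def sys (I : Impl.{uP, uVar, uVal, uOp, uRet, uS} Var Val O) :
    LTS (Event P Var Val O.Op O.Ret) where
  State := ∀ p : P, I.ProcState p
  init := fun _ => none
  Tr := fun s e s' => ∃ (p : P) (q' : I.ProcState p),
    I.ProcTr p (s p) e q' ∧ s' = Function.update s p q'

/-- The histories generated by `I` after `π₀` under the memory model `M`. -/
def histories (I : Impl.{uP, uVar, uVal, uOp, uRet, uS} Var Val O)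
    (π₀ : List (Event P Var Val O.Op O.Ret)) (M : MemoryModel.{uP, uVar, uVal} P Var Val) :
    Set (List (ObjEvent P O.Op O.Ret)) :=
  {h | ∃ π, π₀ ++ π ∈ I.sys.traces ∧ restrictMem (π₀ ++ π) ∈ M.otraces ∧ h = restrictObj π}

/-- `I` is consistent under `M`: every complete history it generates under `M` has a
linearization in the specification. -/
def Consistent (I : Impl.{uP, uVar, uVal, uOp, uRet, uS} Var Val O)
    (M : MemoryModel.{uP, uVar, uVal} P Var Val) : Prop :=
  ∀ h ∈ I.histories [] M, Complete h → ∃ h' ∈ O.Spec, Linearizes h h'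

variable [DecidableEq Var] [Zero Val]

/-- `I` is available after `h₀` with respect to `h`. -/
def Available (I : Impl.{uP, uVar, uVal, uOp, uRet, uS} Var Val O)
    (h₀ h : List (ObjEvent P O.Op O.Ret)) : Prop :=
  ∀ π₀ ∈ I.sys.traces, restrictMem π₀ ∈ (SCM P Var Val).otraces → restrictObj π₀ = h₀ →
    h ∈ I.histories π₀ (SCM P Var Val)

/-- `I` is spec-available: it can generate, under `SCM`, every continuation that the
specification allows. -/
def SpecAvailable (I : Impl.{uP, uVar, uVal, uOp, uRet, uS} Var Val O) : Prop :=
  ∀ h₀ h : List (ObjEvent P O.Op O.Ret), CompleteSequential h₀ → CompleteSequential h →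
    h₀ ++ h ∈ O.Spec → I.Available h₀ h

end Impl

/-! ### The (non-monotone) counter -/

/-- Operations of the counter. -/
inductive CounterOp
  | inc
  | dec
  | read

/-- Response values of the counter. -/
inductive CounterRet
  | ack
  | val (n : ℤ)

/-- The contribution of an object event to the value of the counter. -/
def counterDelta {P : Type uP} : ObjEvent P CounterOp CounterRet → ℤ
  | (_, .inv .inc) => 1
  | (_, .inv .dec) => -1
  | _ => 0

/-- The value of the counter after a complete sequential history:
the number of `inc` operations minus the number of `dec` operations. -/
def counterValue {P : Type uP} (h : List (ObjEvent P CounterOp CounterRet)) : ℤ :=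
  (h.map counterDelta).sum

/-- The response that an operation has to return after the history `h`. -/
def counterResponse {P : Type uP} (h : List (ObjEvent P CounterOp CounterRet)) :
    CounterOp → CounterRet
  | .inc => .ack
  | .dec => .ack
  | .read => .val (counterValue h)

/-- The counter object with initial value `0`: its specification consists of the complete
sequential histories in which `inc` and `dec` return `ack`, and every `read` returns the
number of preceding `inc`s minus the number of preceding `dec`s. -/
def Counter (P : Type uP) [DecidableEq P] : Obj P where
  Op := CounterOp
  Ret := CounterRet
  Spec := {h | CompleteSequential h ∧
    ∀ (g : List (ObjEvent P CounterOp CounterRet)) (p : P) (o : CounterOp) (u : CounterRet),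
      g ++ invres p o u <+: h → u = counterResponse g o}
  spec_complete := fun _ hh => hh.1
  spec_prefix := fun _ hh _ hc hp => ⟨hc, fun g p o u hg => hh.2 g p o u (hg.trans hp)⟩

end WeakMem

namespace WeakMem

universe uP uVar uVal uOp uRet uL uS

/-! ### Execution fragments of transition systems. -/

namespace LTS

variable {L : Type uL} {A : LTS.{uL, uS} L}

/-! Without the forbidden patterns, the memory model cannot prevent an update from being hidden from
a `read`. Spec-availability supplies solo executions under strict consistency of an update followed
by a `read` with value `1` (after `inc`) or `-1` (after `dec`). In each model these pieces are
interleaved into a run in which every process still sees what it saw alone, and the resulting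
history has no linearization.

SCM: if the `inc` of `p` never writes, its `read` returns `1` already from the initial memory.
Otherwise `p` is paused just before its first write while `p'` performs a whole `inc`. By RBW every
later read of `p` is of the variable written last, and that write is its own, so the effect of `p'`
is invisible and `p` reads `1` after two `inc`s (`exists_exec_of_rbw`, `read_after_two`).

TSO: by LTF the fences of `inc` followed by `read` form an initial and a final block. The initial
block lies inside the `inc` and the final one inside the `read`; otherwise one of the two operations
consists of fences only, and the `read` would return `1` from the initial memory. Hence two
processes can both perform an `inc` with all writes left in their buffers, and one of them then
reads `1` from its own buffer and the untouched memory (`TSO.exists_run`).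

RA: `p₂` runs a `dec` up to its trailing fences, `p₁` runs `inc` and reads `1` without acquiring any
message, and `p₃`, whose leading fences were executed at the very start, acquires only the view of
`p₂` and reads `-1` (`RA.exists_run`). Going from one value to the other takes two updates of the
same sign, but there is only one of each (`read_both_signs`). -/

theorem Steps.append {q q' q'' : A.State} {π π' : List L} (h : A.Steps q π q')
    (h' : A.Steps q' π' q'') : A.Steps q (π ++ π') q'' := by
  induction h with
  | nil => exact h'
  | cons ht _ ih => exact .cons ht (ih h')

theorem Steps.of_append {q q'' : A.State} {π π' : List L} (h : A.Steps q (π ++ π') q'') :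
    ∃ q', A.Steps q π q' ∧ A.Steps q' π' q'' := by
  induction π generalizing q with
  | nil => exact ⟨q, .nil q, h⟩
  | cons l π ih =>
    cases h with
    | cons ht hs =>
      obtain ⟨q', h₁, h₂⟩ := ih hs
      exact ⟨q', .cons ht h₁, h₂⟩

theorem steps_nil_iff {q q' : A.State} : A.Steps q [] q' ↔ q = q' :=
  ⟨fun h => by cases h; rfl, fun h => h ▸ .nil q⟩

theorem steps_cons_iff {q q'' : A.State} {l : L} {π : List L} :
    A.Steps q (l :: π) q'' ↔ ∃ q', A.Tr q l q' ∧ A.Steps q' π q'' :=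
  ⟨fun h => by cases h with | cons ht hs => exact ⟨_, ht, hs⟩, fun ⟨_, ht, hs⟩ => .cons ht hs⟩

theorem Steps.single {q q' : A.State} {l : L} (h : A.Tr q l q') : A.Steps q [l] q' :=
  .cons h (.nil _)

end LTS

/-! ### Observable runs of a memory model, and solo runs under strict consistency. -/

section Runs

variable {P : Type uP} {Var : Type uVar} {Val : Type uVal}

/-- `M` has an execution fragment from `μ` to `μ'` with observable sequence `σ`. -/
def MemoryModel.Run (M : MemoryModel.{uP, uVar, uVal, uS} P Var Val) (μ : M.State)
    (σ : List (MemEvent P Var Val)) (μ' : M.State) : Prop :=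
  ∃ ρ, LTS.Steps M μ ρ μ' ∧ σ = ρ.reduceOption

variable {M : MemoryModel.{uP, uVar, uVal, uS} P Var Val}

theorem MemoryModel.Run.nil (μ : M.State) : M.Run μ [] μ := ⟨[], .nil _, rfl⟩

theorem MemoryModel.Run.append {μ μ' μ'' : M.State} {σ σ' : List (MemEvent P Var Val)}
    (h : M.Run μ σ μ') (h' : M.Run μ' σ' μ'') : M.Run μ (σ ++ σ') μ'' := by
  obtain ⟨ρ, hs, rfl⟩ := h
  obtain ⟨ρ', hs', rfl⟩ := h'
  exact ⟨ρ ++ ρ', hs.append hs', (List.reduceOption_append _ _).symm⟩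

theorem MemoryModel.Run.of_append {μ μ'' : M.State} {σ σ' : List (MemEvent P Var Val)}
    (h : M.Run μ (σ ++ σ') μ'') : ∃ μ', M.Run μ σ μ' ∧ M.Run μ' σ' μ'' := by
  obtain ⟨ρ, hs, hρ⟩ := h
  obtain ⟨ρ₁, ρ₂, rfl, h₁, h₂⟩ := List.filterMap_eq_append_iff.mp hρ.symm
  obtain ⟨μ', hs₁, hs₂⟩ := hs.of_append
  exact ⟨μ', ⟨ρ₁, hs₁, h₁.symm⟩, ⟨ρ₂, hs₂, h₂.symm⟩⟩

theorem MemoryModel.Run.event {μ μ' : M.State} {e : MemEvent P Var Val}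
    (h : M.Tr μ (some e) μ') : M.Run μ [e] μ' :=
  ⟨[some e], .single h, by simp⟩

theorem MemoryModel.Run.silent {μ μ' : M.State} (h : M.Tr μ none μ') : M.Run μ [] μ' :=
  ⟨[none], .single h, by simp⟩

/-- The memory events in which `p` performs the actions `τ`. -/
def byProc (p : P) (τ : List (MemAct Var Val)) : List (MemEvent P Var Val) :=
  τ.map (Prod.mk p)

@[simp] theorem byProc_nil (p : P) : byProc p ([] : List (MemAct Var Val)) = [] := rfl

@[simp] theorem byProc_cons (p : P) (a : MemAct Var Val) (τ : List (MemAct Var Val)) :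
    byProc p (a :: τ) = (p, a) :: byProc p τ := rfl

@[simp] theorem byProc_append (p : P) (τ τ' : List (MemAct Var Val)) :
    byProc p (τ ++ τ') = byProc p τ ++ byProc p τ' := List.map_append

/-- No action of the sequence is a read-modify-write. -/
def NoRMW (τ : List (MemAct Var Val)) : Prop :=
  ∀ x v w, MemAct.RMW x v w ∉ τ

theorem noRMW_of_not_hasRMW {p : P} {τ : List (MemAct Var Val)} (h : ¬ HasRMW (byProc p τ)) :
    NoRMW τ := fun x v w hm => h ⟨p, x, v, w, List.mem_map_of_mem hm⟩

theorem NoRMW.of_append {τ τ' : List (MemAct Var Val)} (h : NoRMW (τ ++ τ')) :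
    NoRMW τ ∧ NoRMW τ' :=
  ⟨fun x v w hm => h x v w (List.mem_append_left _ hm),
    fun x v w hm => h x v w (List.mem_append_right _ hm)⟩

theorem NoRMW.tail {a : MemAct Var Val} {τ : List (MemAct Var Val)} (h : NoRMW (a :: τ)) :
    NoRMW τ := fun x v w hm => h x v w (List.mem_cons_of_mem _ hm)

variable [DecidableEq Var]

/-- Executing `τ` under strict consistency leads from the memory `m` to the memory `m'`. -/
def Exec : (Var → Val) → List (MemAct Var Val) → (Var → Val) → Prop
  | m, [], m' => m = m'
  | m, .W x v :: τ, m' => Exec (Function.update m x v) τ m'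
  | m, .R x v :: τ, m' => m x = v ∧ Exec m τ m'
  | m, .RMW x v w :: τ, m' => m x = v ∧ Exec (Function.update m x w) τ m'
  | m, .F :: τ, m' => Exec m τ m'

theorem exec_append {m m' : Var → Val} {τ τ' : List (MemAct Var Val)} :
    Exec m (τ ++ τ') m' ↔ ∃ n, Exec m τ n ∧ Exec n τ' m' := by
  induction τ generalizing m with
  | nil => simp [Exec]
  | cons a τ ih => cases a <;> simp [Exec, ih, and_assoc]

/-- An update without writes leaves no trace in memory, so a later operation behaves as if it had
not happened. -/
theorem Exec.eq_of_no_write {m m' : Var → Val} {τ : List (MemAct Var Val)} (h : Exec m τ m')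
    (hR : NoRMW τ) (hW : ∀ x v, MemAct.W x v ∉ τ) : m = m' := by
  induction τ with
  | nil => exact h
  | cons a τ ih =>
    have hW' : ∀ x v, MemAct.W x v ∉ τ := fun x v hm => hW x v (List.mem_cons_of_mem _ hm)
    cases a with
    | W x v => exact absurd List.mem_cons_self (hW x v)
    | R x v => exact ih h.2 hR.tail hW'
    | RMW x v w => exact absurd List.mem_cons_self (hR x v w)
    | F => exact ih h hR.tail hW'

theorem exec_replicate_fence {m m' : Var → Val} {k : ℕ} :
    Exec m (List.replicate k .F) m' ↔ m = m' := by
  induction k with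
  | zero => rfl
  | succ k ih => simpa [List.replicate_succ, Exec] using ih

variable [Zero Val]

/-- Strict consistency has no silent steps, so its runs follow the action sequence exactly; `Exec`
is the form suited to induction and to transfer to the other models. -/
theorem SCM.run_iff_exec {m m' : Var → Val} {p : P} {τ : List (MemAct Var Val)} :
    (SCM P Var Val).Run m (byProc p τ) m' ↔ Exec m τ m' := by
  constructor
  · rintro ⟨ρ, hs, hρ⟩
    induction τ generalizing m ρ with
    | nil =>
      cases ρ with
      | nil => exact LTS.steps_nil_iff.mp hs
      | cons l ρ =>
        obtain ⟨n, ht, -⟩ := LTS.steps_cons_iff.mp hs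
        cases ht <;> simp at hρ
    | cons a τ ih =>
      cases ρ with
      | nil => simp at hρ
      | cons l ρ =>
        obtain ⟨n, ht, hs₁⟩ := LTS.steps_cons_iff.mp hs
        cases ht <;> simp only [byProc_cons, List.reduceOption_cons_of_some, List.cons.injEq,
          Prod.mk.injEq] at hρ <;> obtain ⟨⟨rfl, rfl⟩, hρ⟩ := hρ <;> simp only [Exec]
        · exact ih _ hs₁ hρ
        · exact ⟨trivial, ih _ hs₁ hρ⟩
        · exact ⟨by assumption, ih _ hs₁ hρ⟩
        · exact ih _ hs₁ hρ
  · intro h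
    induction τ generalizing m with
    | nil => cases h; exact .nil _
    | cons a τ ih =>
      cases a with
      | W x v => exact (MemoryModel.Run.event (SCM.Tr.write m p x v)).append (ih h)
      | R x v =>
        obtain ⟨rfl, h⟩ := h
        exact (MemoryModel.Run.event (SCM.Tr.read m p x)).append (ih h)
      | RMW x v w =>
        exact (MemoryModel.Run.event (SCM.Tr.rmw m p x v w h.1)).append (ih h.2)
      | F => exact (MemoryModel.Run.event (SCM.Tr.fence m p)).append (ih h)

end Runs

/-! ### Restrictions to memory and object events. -/

section Restrict

variable {P : Type uP} {Var : Type uVar} {Val : Type uVal} {Op : Type uOp} {Ret : Type uRet}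

/-- The events in which `p` performs the memory actions `τ`. -/
def memEvents (Op : Type uOp) (Ret : Type uRet) (p : P) (τ : List (MemAct Var Val)) :
    List (Event P Var Val Op Ret) :=
  τ.map fun a => (p, .mem a)

@[simp] theorem restrictMem_append (π π' : List (Event P Var Val Op Ret)) :
    restrictMem (π ++ π') = restrictMem π ++ restrictMem π' := List.filterMap_append

@[simp] theorem restrictObj_append (π π' : List (Event P Var Val Op Ret)) :
    restrictObj (π ++ π') = restrictObj π ++ restrictObj π' := List.filterMap_append

@[simp] theorem restrictMem_nil : restrictMem ([] : List (Event P Var Val Op Ret)) = [] := rfl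

@[simp] theorem restrictObj_nil : restrictObj ([] : List (Event P Var Val Op Ret)) = [] := rfl

@[simp] theorem restrictMem_cons_obj (p : P) (a : ObjAct Op Ret)
    (π : List (Event P Var Val Op Ret)) :
    restrictMem ((p, .obj a) :: π) = restrictMem π := rfl

@[simp] theorem restrictObj_cons_obj (p : P) (a : ObjAct Op Ret)
    (π : List (Event P Var Val Op Ret)) :
    restrictObj ((p, .obj a) :: π) = (p, a) :: restrictObj π := rfl

@[simp] theorem restrictObj_cons_mem (p : P) (a : MemAct Var Val)
    (π : List (Event P Var Val Op Ret)) :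
    restrictObj ((p, .mem a) :: π) = restrictObj π := rfl

@[simp] theorem restrictMem_memEvents (p : P) (τ : List (MemAct Var Val)) :
    restrictMem (memEvents Op Ret p τ) = byProc p τ := by
  induction τ with
  | nil => rfl
  | cons a τ ih => exact congrArg (List.cons (p, a)) ih

@[simp] theorem restrictObj_memEvents (p : P) (τ : List (MemAct Var Val)) :
    restrictObj (memEvents Op Ret p τ) = [] := by
  induction τ with
  | nil => rfl
  | cons a τ ih => exact ih

theorem memEvents_append (p : P) (τ τ' : List (MemAct Var Val)) :
    memEvents Op Ret p (τ ++ τ') = memEvents Op Ret p τ ++ memEvents Op Ret p τ' :=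
  List.map_append

end Restrict

/-! ### Decomposing runs of the system into operations, and composing them. -/

namespace Impl

variable {P : Type uP} [DecidableEq P] {Var : Type uVar} {Val : Type uVal}
variable {O : Obj.{uP, uOp, uRet} P} {I : Impl.{uP, uVar, uVal, uOp, uRet, uS} Var Val O}

/-- The implementation of `o` for `p` can perform the memory actions `τ` and return `u`. -/
def Runs (I : Impl.{uP, uVar, uVal, uOp, uRet, uS} Var Val O) (o : O.Op) (p : P)
    (τ : List (MemAct Var Val)) (u : O.Ret) : Prop :=
  ∃ q q', (I o p).lts.Steps (I o p).lts.init (memEvents O.Op O.Ret p τ) q ∧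
    (I o p).lts.Tr q (p, .obj (.res u)) q'

theorem Runs.mem_traces {o : O.Op} {p : P} {τ : List (MemAct Var Val)} {u : O.Ret}
    (h : I.Runs o p τ u) : memEvents O.Op O.Ret p τ ∈ (I o p).lts.traces :=
  let ⟨q, _, hs, _⟩ := h
  ⟨q, hs⟩

/-- Execution fragments of the system of all processes. -/
def SysSteps (I : Impl.{uP, uVar, uVal, uOp, uRet, uS} Var Val O) (s : ∀ p, I.ProcState p)
    (π : List (Event P Var Val O.Op O.Ret)) (s' : ∀ p, I.ProcState p) : Prop :=
  I.sys.Steps s π s'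

theorem sysSteps_nil_iff {s s' : ∀ p, I.ProcState p} : I.SysSteps s [] s' ↔ s = s' :=
  LTS.steps_nil_iff

theorem sysSteps_cons_iff {s s' : ∀ p, I.ProcState p} {e : Event P Var Val O.Op O.Ret}
    {π : List (Event P Var Val O.Op O.Ret)} :
    I.SysSteps s (e :: π) s' ↔
      ∃ p t, I.ProcTr p (s p) e t ∧ I.SysSteps (Function.update s p t) π s' := by
  refine LTS.steps_cons_iff.trans ⟨?_, ?_⟩
  · rintro ⟨_, ⟨p, t, ht, rfl⟩, hs⟩
    exact ⟨p, t, ht, hs⟩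
  · rintro ⟨p, t, ht, hs⟩
    exact ⟨_, ⟨p, t, ht, rfl⟩, hs⟩

/-- An idle process can only invoke, which would put an invocation into the object restriction. So
only `p` moves until it responds, and nothing can follow the response. -/
theorem exists_steps_of_running {s s' : ∀ p, I.ProcState p}
    {π : List (Event P Var Val O.Op O.Ret)}
    {p : P} {o : O.Op} {u : O.Ret} {q : (I o p).lts.State} (h : I.SysSteps s π s')
    (hp : s p = some ⟨o, q⟩) (hne : ∀ p', p' ≠ p → s p' = none)
    (hπ : restrictObj π = [(p, .res u)]) :
    ∃ τ q' q'', (I o p).lts.Steps q (memEvents O.Op O.Ret p τ) q' ∧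
      (I o p).lts.Tr q' (p, .obj (.res u)) q'' ∧
      π = memEvents O.Op O.Ret p τ ++ [(p, .obj (.res u))] ∧ s' = fun _ => none := by
  induction π generalizing s q with
  | nil => simp at hπ
  | cons e π ih =>
    obtain ⟨p', t, ht, hs⟩ := sysSteps_cons_iff.mp h
    by_cases hpp : p' = p
    · subst hpp
      rw [hp] at ht
      cases ht with
      | memory _ _ q' a ha =>
        obtain ⟨τ, q₁, q₂, h₁, h₂, rfl, h₃⟩ := ih (q := q') hs (Function.update_self ..)
          (fun r hr => by rw [Function.update_of_ne hr, hne r hr]) hπ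
        exact ⟨a :: τ, q₁, q₂, .cons ha h₁, h₂, rfl, h₃⟩
      | respond _ _ q' u' hu =>
        simp only [restrictObj_cons_obj, List.cons.injEq, Prod.mk.injEq, ObjAct.res.injEq,
          true_and] at hπ
        obtain ⟨rfl, hπ⟩ := hπ
        have hnone : Function.update s p' none = fun _ => none := by
          funext r
          by_cases hr : r = p'
          · subst hr; exact Function.update_self ..
          · rw [Function.update_of_ne hr, hne r hr]
        rw [hnone] at hs
        cases π with
        | nil => exact ⟨[], q, q', .nil _, hu, rfl, (sysSteps_nil_iff.mp hs).symm⟩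
        | cons e π =>
          obtain ⟨r, t, ht, -⟩ := sysSteps_cons_iff.mp hs
          cases ht
          simp at hπ
    · rw [hne p' hpp] at ht
      cases ht
      simp at hπ

theorem exists_runs_of_idle {s' : ∀ p, I.ProcState p} {π : List (Event P Var Val O.Op O.Ret)}
    {p : P} {o : O.Op} {u : O.Ret} (h : I.SysSteps (fun _ => none) π s')
    (hπ : restrictObj π = invres p o u) :
    ∃ τ, I.Runs o p τ u ∧
      π = (p, .obj (.inv o)) :: (memEvents O.Op O.Ret p τ ++ [(p, .obj (.res u))]) ∧
      s' = fun _ => none := by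
  cases π with
  | nil => simp [invres] at hπ
  | cons e π =>
    obtain ⟨p', t, ht, hs⟩ := sysSteps_cons_iff.mp h
    cases ht with
    | invoke o' =>
      simp only [invres, restrictObj_cons_obj, List.cons.injEq, Prod.mk.injEq,
        ObjAct.inv.injEq] at hπ
      obtain ⟨⟨rfl, rfl⟩, hπ⟩ := hπ
      obtain ⟨τ, q, q', h₁, h₂, rfl, h₃⟩ := exists_steps_of_running (u := u) hs
        (Function.update_self ..) (fun r hr => by rw [Function.update_of_ne hr]) hπ
      exact ⟨τ, ⟨q, q', h₁, h₂⟩, rfl, h₃⟩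

/-- Joint executions of the processes and of the memory model. -/
def Joint (I : Impl.{uP, uVar, uVal, uOp, uRet, uS} Var Val O)
    (M : MemoryModel.{uP, uVar, uVal} P Var Val) (s : ∀ p, I.ProcState p) (μ : M.State)
    (π : List (Event P Var Val O.Op O.Ret)) (s' : ∀ p, I.ProcState p) (μ' : M.State) : Prop :=
  I.SysSteps s π s' ∧ M.Run μ (restrictMem π) μ'

variable {M : MemoryModel.{uP, uVar, uVal} P Var Val}

theorem Joint.append {s s' s'' : ∀ p, I.ProcState p} {μ μ' μ'' : M.State}
    {π π' : List (Event P Var Val O.Op O.Ret)} (h : I.Joint M s μ π s' μ')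
    (h' : I.Joint M s' μ' π' s'' μ'') : I.Joint M s μ (π ++ π') s'' μ'' :=
  ⟨LTS.Steps.append h.1 h'.1, by rw [restrictMem_append]; exact h.2.append h'.2⟩

theorem Joint.mem_histories {s : ∀ p, I.ProcState p} {μ : M.State}
    {π : List (Event P Var Val O.Op O.Ret)} (h : I.Joint M (fun _ => none) M.init π s μ) :
    restrictObj π ∈ I.histories [] M :=
  ⟨π, ⟨s, h.1⟩, let ⟨ρ, hs, hρ⟩ := h.2; ⟨ρ, ⟨μ, hs⟩, hρ⟩, rfl⟩

theorem Joint.mem {s : ∀ p, I.ProcState p} {μ μ' : M.State} {p : P} {o : O.Op}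
    {q q' : (I o p).lts.State} {τ : List (MemAct Var Val)} (hp : s p = some ⟨o, q⟩)
    (h : (I o p).lts.Steps q (memEvents O.Op O.Ret p τ) q') (hM : M.Run μ (byProc p τ) μ') :
    I.Joint M s μ (memEvents O.Op O.Ret p τ) (Function.update s p (some ⟨o, q'⟩)) μ' := by
  refine ⟨?_, by rwa [restrictMem_memEvents]⟩
  clear hM
  induction τ generalizing s q with
  | nil =>
    obtain rfl := LTS.steps_nil_iff.mp h
    rw [← hp, Function.update_eq_self]
    exact sysSteps_nil_iff.mpr rfl
  | cons a τ ih =>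
    obtain ⟨q₁, ht, hs⟩ := LTS.steps_cons_iff.mp h
    have := ih (s := Function.update s p (some ⟨o, q₁⟩)) (Function.update_self ..) hs
    rw [Function.update_idem] at this
    exact sysSteps_cons_iff.mpr ⟨p, _, hp ▸ ProcTr.memory o q q₁ a ht, this⟩

theorem Joint.begin {s : ∀ p, I.ProcState p} {μ μ' : M.State} {p : P} {o : O.Op}
    {q : (I o p).lts.State} {τ : List (MemAct Var Val)} (hp : s p = none)
    (h : (I o p).lts.Steps (I o p).lts.init (memEvents O.Op O.Ret p τ) q)
    (hM : M.Run μ (byProc p τ) μ') :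
    I.Joint M s μ ((p, .obj (.inv o)) :: memEvents O.Op O.Ret p τ)
      (Function.update s p (some ⟨o, q⟩)) μ' := by
  have h₁ : I.Joint M s μ [(p, .obj (.inv o))]
      (Function.update s p (some ⟨o, (I o p).lts.init⟩)) μ :=
    ⟨sysSteps_cons_iff.mpr ⟨p, _, hp ▸ ProcTr.invoke o, sysSteps_nil_iff.mpr rfl⟩, .nil μ⟩
  have h₂ := h₁.append (Joint.mem (Function.update_self ..) h hM)
  rwa [Function.update_idem] at h₂

theorem Joint.finish {s : ∀ p, I.ProcState p} {μ μ' : M.State} {p : P} {o : O.Op}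
    {q q' q'' : (I o p).lts.State} {τ : List (MemAct Var Val)} {u : O.Ret}
    (hp : s p = some ⟨o, q⟩)
    (h : (I o p).lts.Steps q (memEvents O.Op O.Ret p τ) q')
    (hu : (I o p).lts.Tr q' (p, .obj (.res u)) q'')
    (hM : M.Run μ (byProc p τ) μ') :
    I.Joint M s μ (memEvents O.Op O.Ret p τ ++ [(p, .obj (.res u))])
      (Function.update s p none) μ' := by
  have h₁ : I.Joint M (Function.update s p (some ⟨o, q'⟩)) μ' [(p, .obj (.res u))]
      (Function.update (Function.update s p (some ⟨o, q'⟩)) p none) μ' :=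
    ⟨sysSteps_cons_iff.mpr ⟨p, _, by
      rw [Function.update_self]; exact .respond o q' q'' u hu, sysSteps_nil_iff.mpr rfl⟩, .nil μ'⟩
  have h₂ := (Joint.mem hp h hM).append h₁
  rwa [Function.update_idem] at h₂

theorem Joint.operation {s : ∀ p, I.ProcState p} {μ μ' : M.State} {p : P} {o : O.Op}
    {τ : List (MemAct Var Val)} {u : O.Ret} (hp : s p = none) (h : I.Runs o p τ u)
    (hM : M.Run μ (byProc p τ) μ') :
    I.Joint M s μ ((p, .obj (.inv o)) :: (memEvents O.Op O.Ret p τ ++ [(p, .obj (.res u))]))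
      s μ' := by
  obtain ⟨q, q', hs, hu⟩ := h
  have h₁ := (Joint.begin hp hs hM).append
    (Joint.finish (τ := []) (Function.update_self ..) (.nil _) hu (.nil _))
  rw [Function.update_idem, ← hp, Function.update_eq_self] at h₁
  exact h₁

theorem Runs.mem_histories {p : P} {o : O.Op} {τ : List (MemAct Var Val)} {u : O.Ret}
    (h : I.Runs o p τ u) {μ : M.State} (hM : M.Run M.init (byProc p τ) μ) :
    invres p o u ∈ I.histories [] M := by
  have hj := (Joint.operation (s := fun _ => none) rfl h hM).mem_histories
  simpa [invres] using hj

/-- `p'` performs an operation during an operation of `p`, which then performs another one. -/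
theorem nested_mem_histories {p p' : P} (hp : p ≠ p') {o o₂ o' : O.Op}
    {α β γ δ : List (MemAct Var Val)} {u u₂ u' : O.Ret} (h : I.Runs o p (α ++ β) u)
    (h₂ : I.Runs o₂ p δ u₂) (h' : I.Runs o' p' γ u') {μ : M.State}
    (hM : M.Run M.init (byProc p α ++ byProc p' γ ++ byProc p β ++ byProc p δ) μ) :
    [(p, .inv o), (p', .inv o'), (p', .res u'), (p, .res u), (p, .inv o₂), (p, .res u₂)] ∈
      I.histories [] M := by
  obtain ⟨μ₃, hM, hδ⟩ := hM.of_append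
  obtain ⟨μ₂, hM, hβ⟩ := hM.of_append
  obtain ⟨μ₁, hα, hγ⟩ := hM.of_append
  obtain ⟨q, q', hq, hu⟩ := h
  rw [memEvents_append] at hq
  obtain ⟨q₁, hq₁, hq⟩ := hq.of_append
  have j₁ := Joint.begin (s := fun _ => none) rfl hq₁ hα
  have j₂ := j₁.append (Joint.operation (by simp [hp.symm]) h' hγ)
  have j₃ := j₂.append (Joint.finish (Function.update_self ..) hq hu hβ)
  have j₄ := j₃.append (Joint.operation (Function.update_self ..) h₂ hδ)
  simpa using j₄.mem_histories

/-- `p₁` performs two operations during operations of `p₂` and `p₃`. -/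
theorem overlapping_mem_histories {p₁ p₂ p₃ : P} (h₁₂ : p₁ ≠ p₂) (h₁₃ : p₁ ≠ p₃) (h₂₃ : p₂ ≠ p₃)
    {o₁ o₁' o₂ o₃ : O.Op} {α α' β β' γ γ' : List (MemAct Var Val)} {u₁ u₁' u₂ u₃ : O.Ret}
    (h₁ : I.Runs o₁ p₁ α u₁) (h₁' : I.Runs o₁' p₁ α' u₁') (h₂ : I.Runs o₂ p₂ (β ++ β') u₂)
    (h₃ : I.Runs o₃ p₃ (γ ++ γ') u₃) {μ : M.State}
    (hM : M.Run M.init (byProc p₃ γ ++ byProc p₂ β ++ byProc p₁ α ++ byProc p₁ α' ++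
      byProc p₃ γ' ++ byProc p₂ β') μ) :
    [(p₃, .inv o₃), (p₂, .inv o₂), (p₁, .inv o₁), (p₁, .res u₁), (p₁, .inv o₁'), (p₁, .res u₁'),
      (p₃, .res u₃), (p₂, .res u₂)] ∈ I.histories [] M := by
  obtain ⟨μ₅, hM, hβ'⟩ := hM.of_append
  obtain ⟨μ₄, hM, hγ'⟩ := hM.of_append
  obtain ⟨μ₃, hM, hα'⟩ := hM.of_append
  obtain ⟨μ₂, hM, hα⟩ := hM.of_append
  obtain ⟨μ₁, hγ, hβ⟩ := hM.of_append
  obtain ⟨q₂, r₂, hq₂, hr₂⟩ := h₂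
  obtain ⟨q₃, r₃, hq₃, hr₃⟩ := h₃
  rw [memEvents_append] at hq₂ hq₃
  obtain ⟨q₂', hq₂', hq₂⟩ := hq₂.of_append
  obtain ⟨q₃', hq₃', hq₃⟩ := hq₃.of_append
  have j₁ := Joint.begin (s := fun _ => none) rfl hq₃' hγ
  have j₂ := j₁.append (Joint.begin (by simp [h₂₃]) hq₂' hβ)
  have j₃ := j₂.append (Joint.operation (by simp [h₁₂, h₁₃]) h₁ hα)
  have j₄ := j₃.append (Joint.operation (by simp [h₁₂, h₁₃]) h₁' hα')
  have j₅ := j₄.append (Joint.finish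
    (by rw [Function.update_of_ne h₂₃.symm, Function.update_self]) hq₃ hr₃ hγ')
  have j₆ := j₅.append (Joint.finish
    (by rw [Function.update_of_ne h₂₃, Function.update_self]) hq₂ hr₂ hβ')
  simpa using j₆.mem_histories

variable [DecidableEq Var] [Zero Val]

/-- Spec-availability yields solo executions under strict consistency
of two successive operations. -/
theorem SpecAvailable.exists_runs (hI : I.SpecAvailable) {p p' : P} {o o' : O.Op} {u u' : O.Ret}
    (h₁ : CompleteSequential (invres p o u)) (h₂ : CompleteSequential (invres p' o' u'))
    (h : invres p o u ++ invres p' o' u' ∈ O.Spec) :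
    ∃ τ τ' m m', I.Runs o p τ u ∧ I.Runs o' p' τ' u' ∧
      Exec (fun _ => 0) τ m ∧ Exec m τ' m' := by
  have hnil : CompleteSequential ([] : List (ObjEvent P O.Op O.Ret)) :=
    ⟨⟨fun _ => ⟨[], by simp⟩, by simp⟩, [], by simp⟩
  have h₀ : [] ++ invres p o u ∈ O.Spec := O.spec_prefix _ h _ h₁ (List.prefix_append _ _)
  obtain ⟨π, ⟨s, hs⟩, ⟨ρ, ⟨μ, hρ⟩, hρπ⟩, hπ⟩ :=
    hI [] _ hnil h₁ h₀ [] ⟨_, .nil _⟩ ⟨[], ⟨_, .nil _⟩, rfl⟩ rfl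
  obtain ⟨τ, hτ, rfl, rfl⟩ := exists_runs_of_idle hs hπ.symm
  obtain ⟨π', ⟨s', hs'⟩, ⟨ρ', ⟨μ', hρ'⟩, hρπ'⟩, hπ'⟩ :=
    hI _ _ h₁ h₂ h _ ⟨_, hs⟩ ⟨ρ, ⟨μ, hρ⟩, hρπ⟩ hπ.symm
  -- The new run may pass through other states on the first operation than the earlier one did, but
  -- it too must end that operation with all processes idle.
  obtain ⟨s₁, hs₁, hs₂⟩ := hs'.of_append
  obtain ⟨-, -, -, rfl⟩ := exists_runs_of_idle hs₁ hπ.symm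
  obtain ⟨τ', hτ', rfl, -⟩ := exists_runs_of_idle hs₂ hπ'.symm
  have hrun : (SCM P Var Val).Run (fun _ => 0) (byProc p τ ++ byProc p' τ') μ' :=
    ⟨ρ', hρ', by simpa using hρπ'⟩
  obtain ⟨m, hm, hm'⟩ := hrun.of_append
  exact ⟨τ, τ', m, μ', hτ, hτ', SCM.run_iff_exec.mp hm, SCM.run_iff_exec.mp hm'⟩

end Impl

/-! ### Reorderings of lists without duplicates. -/

section Reordering

variable {X : Type*} {R : X → X → Prop} {s s' : List X}

theorem IsReordering.perm (h : IsReordering R s s') : s.Perm s' := by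
  obtain ⟨f, hf, -⟩ := h
  rw [← Multiset.coe_eq_coe, ← List.ofFn_get s, ← List.ofFn_get s', ← Fin.univ_val_map,
    ← Fin.univ_val_map, ← Finset.map_univ_equiv f, Finset.map_val, Multiset.map_map]
  exact Multiset.map_congr rfl fun i _ => hf i

/-- Without duplicates an event determines its position, so the order of indices that the bijection
preserves becomes membership in the prefix before `b`. -/
theorem IsReordering.mem_of_order (h : IsReordering R s s') (hs : s.Nodup) {s₁ s₂ g k : List X}
    {a b : X} (hs₁ : s = s₁ ++ b :: s₂) (ha : a ∈ s₁) (hR : R a b) (hs' : s' = g ++ b :: k) :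
    a ∈ g := by
  have hnd : s'.Nodup := h.perm.nodup_iff.mp hs
  obtain ⟨f, hf, hlt⟩ := h
  obtain ⟨i, hi, hia⟩ := List.getElem_of_mem ha
  have hi' : i < s.length := by rw [hs₁]; simp; omega
  have hj' : s₁.length < s.length := by rw [hs₁]; simp
  have hg' : g.length < s'.length := by rw [hs']; simp
  have hai : s.get ⟨i, hi'⟩ = a := by
    subst hs₁
    simp [List.getElem_append_left hi, hia]
  have hbj : s.get ⟨s₁.length, hj'⟩ = b := by subst hs₁; simp
  have hbg : s'.get ⟨g.length, hg'⟩ = b := by subst hs'; simp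
  have hlt' := hlt ⟨i, hi'⟩ ⟨s₁.length, hj'⟩ hi (by rw [hai, hbj]; exact hR)
  have hfj : f ⟨s₁.length, hj'⟩ = ⟨g.length, hg'⟩ :=
    List.nodup_iff_injective_get.mp hnd (by rw [← hf, hbj, hbg])
  rw [hfj] at hlt'
  have hfi : ((f ⟨i, hi'⟩ : Fin _) : ℕ) < g.length := hlt'
  have hfa : s'.get (f ⟨i, hi'⟩) = a := by rw [← hf, hai]
  generalize f ⟨i, hi'⟩ = j at hfi hfa
  subst hs'
  rw [← hfa]
  simp [List.getElem_append_left hfi]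

end Reordering

/-! ### Complete and sequential histories. -/

section Histories

variable {P : Type uP} {Op : Type uOp} {Ret : Type uRet}

theorem exists_prefix_of_mem_sequential {h : List (ObjEvent P Op Ret)} (hs : Sequential h)
    {p : P} {u : Ret} (hm : (p, .res u) ∈ h) : ∃ g o, g ++ invres p o u <+: h := by
  obtain ⟨l, hl⟩ := hs
  induction l generalizing h with
  | nil => simp_all
  | cons c l ih =>
    rw [List.flatMap_cons, invres, List.cons_append, List.cons_append, List.nil_append] at hl
    rcases h with - | ⟨a, - | ⟨b, h⟩⟩
    · simp at hm
    · obtain ⟨rfl, -⟩ := List.cons_prefix_cons.mp hl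
      simp at hm
    · simp only [List.cons_prefix_cons] at hl
      obtain ⟨rfl, rfl, hl⟩ := hl
      simp only [List.mem_cons, Prod.mk.injEq, reduceCtorEq, and_false, ObjAct.res.injEq,
        false_or] at hm
      rcases hm with ⟨rfl, rfl⟩ | hm
      · exact ⟨[], c.2.1, by simp [invres]⟩
      · obtain ⟨g, o, hg⟩ := ih hm hl
        exact ⟨(c.1, .inv c.2.1) :: (c.1, .res c.2.2) :: g, o, by simpa using hg⟩

variable [DecidableEq P]

/-- Completeness is checked process by process; exhibiting the finished operations of each process
covers both well-formedness and the final response. -/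
theorem complete_of_forall_filter {h : List (ObjEvent P Op Ret)}
    (hl : ∀ p, ∃ l : List (P × Op × Ret),
      h.filter (fun e => e.1 = p) = l.flatMap fun c => invres c.1 c.2.1 c.2.2) :
    Complete h := by
  refine ⟨fun p => ?_, fun p e he => ?_⟩ <;> obtain ⟨l, hl⟩ := hl p
  · exact ⟨l, hl ▸ List.prefix_rfl⟩
  · rw [hl] at he
    rcases List.eq_nil_or_concat l with rfl | ⟨l, c, rfl⟩
    · simp at he
    · simp [invres] at he
      exact ⟨c.2.2, he ▸ rfl⟩

theorem completeSequential_flatMap (l : List (P × Op × Ret)) :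
    CompleteSequential (l.flatMap fun c => invres c.1 c.2.1 c.2.2) := by
  refine ⟨complete_of_forall_filter fun p => ⟨l.filter fun c => c.1 = p, ?_⟩, l, List.prefix_rfl⟩
  induction l with
  | nil => rfl
  | cons c l ih =>
    rw [List.flatMap_cons, List.filter_append, ih]
    by_cases hc : c.1 = p <;> simp [invres, hc]

theorem completeSequential_invres (p : P) (o : Op) (u : Ret) :
    CompleteSequential (invres p o u) := by
  simpa using completeSequential_flatMap [(p, o, u)]

end Histories

/-! ### Counter histories that have no linearization. -/

section Counter

variable {P : Type uP}

theorem counterValue_append (h h' : List (ObjEvent P CounterOp CounterRet)) :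
    counterValue (h ++ h') = counterValue h + counterValue h' := by
  simp [counterValue]

/-- Any part of a history has at most as many `inc`s as the whole. The bound does not depend on the
order, hence applies to every piece of every linearization. -/
theorem counterValue_le_of_subperm {g h : List (ObjEvent P CounterOp CounterRet)}
    (hg : g.Subperm h) : counterValue g ≤ (h.map fun e => max (counterDelta e) 0).sum := by
  obtain ⟨l, hl, hs⟩ := hg
  calc counterValue g = (l.map counterDelta).sum := (hl.map _).sum_eq.symm
    _ ≤ (l.map fun e => max (counterDelta e) 0).sum :=
      List.sum_le_sum fun e _ => le_max_left _ _
    _ ≤ _ := (hs.map _).sum_le_sum (List.forall_mem_map.mpr fun _ _ => le_max_right _ _)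

theorem le_counterValue_of_subperm {g h : List (ObjEvent P CounterOp CounterRet)}
    (hg : g.Subperm h) : (h.map fun e => min (counterDelta e) 0).sum ≤ counterValue g := by
  obtain ⟨l, hl, hs⟩ := hg
  have h₁ := (hs.map fun e => -min (counterDelta e) 0).sum_le_sum
    (List.forall_mem_map.mpr fun _ _ => neg_nonneg.mpr (min_le_right _ _))
  have h₂ : (l.map fun e => min (counterDelta e) 0).sum ≤ (l.map counterDelta).sum :=
    List.sum_le_sum fun e _ => min_le_left _ _
  have h₃ : counterValue g = (l.map counterDelta).sum := (hl.map _).sum_eq.symm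
  have h₄ (k : List (ObjEvent P CounterOp CounterRet)) :
      (k.map fun e => -min (counterDelta e) 0).sum =
        -(k.map fun e => min (counterDelta e) 0).sum := by
    induction k with
    | nil => rfl
    | cons e k ih => simp only [List.map_cons, List.sum_cons, ih]; ring
  rw [h₄, h₄] at h₁
  omega

variable [DecidableEq P]

theorem exists_prefix_of_read {h : List (ObjEvent P CounterOp CounterRet)}
    (hh : h ∈ (Counter P).Spec) {p : P} {n : ℤ} (hm : (p, .res (.val n)) ∈ h) :
    ∃ g, g ++ invres p .read (.val n) <+: h ∧ counterValue g = n := by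
  obtain ⟨hc, hr⟩ := hh
  obtain ⟨g, o, hg⟩ := exists_prefix_of_mem_sequential hc.2 hm
  have := hr g p o _ hg
  cases o with
  | inc => cases this
  | dec => cases this
  | read => exact ⟨g, hg, (CounterRet.val.inj this).symm⟩

variable {Var : Type uVar} {Val : Type uVal}
variable {I : Impl.{uP, uVar, uVal, 0, 0, uS} Var Val (Counter P)}
variable {M : MemoryModel.{uP, uVar, uVal} P Var Val}

theorem Impl.Consistent.exists_linearization (hI : I.Consistent M)
    {h : List (ObjEvent P CounterOp CounterRet)} (hh : h ∈ I.histories [] M) (hc : Complete h) :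
    ∃ h' : List (ObjEvent P CounterOp CounterRet), h' ∈ (Counter P).Spec ∧ Linearizes h h' :=
  hI h hh hc

/-- `p` reads the value `1`. -/
def readAlone (p : P) : List (ObjEvent P CounterOp CounterRet) :=
  invres p .read (.val 1)

/-- The history contains no `inc`, so no prefix of a linearization has positive value. -/
theorem Impl.Consistent.read_alone (hI : I.Consistent M) {p : P}
    (h : readAlone p ∈ I.histories [] M) : False := by
  obtain ⟨h', hs, hl⟩ := hI.exists_linearization h (completeSequential_invres ..).1
  obtain ⟨g, ⟨k, hg⟩, hv⟩ := exists_prefix_of_read (p := p) (n := 1) hs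
    (hl.perm.subset (by simp [readAlone, invres]))
  subst hg
  have := counterValue_le_of_subperm
    (((List.sublist_append_left _ _).trans (List.sublist_append_left _ _)).subperm.trans
      hl.perm.symm.subperm)
  rw [hv] at this
  simp [readAlone, counterDelta, invres] at this

/-- `p'` performs an `inc` during an `inc` of `p`; then `p` reads the value `1`. -/
def readAfterTwo (p p' : P) : List (ObjEvent P CounterOp CounterRet) :=
  [(p, .inv .inc), (p', .inv .inc), (p', .res .ack), (p, .res .ack),
    (p, .inv .read), (p, .res (.val 1))]

/-- While `p₂` performs a `dec` and `p₃` performs a `read` with value `-1`, `p₁` performs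
an `inc`, and then a `read` with value `1`. -/
def readBothSigns (p₁ p₂ p₃ : P) : List (ObjEvent P CounterOp CounterRet) :=
  [(p₃, .inv .read), (p₂, .inv .dec), (p₁, .inv .inc), (p₁, .res .ack),
    (p₁, .inv .read), (p₁, .res (.val 1)), (p₃, .res (.val (-1))), (p₂, .res .ack)]

theorem Impl.Consistent.read_after_two (hI : I.Consistent M) {p p' : P} (hp : p ≠ p')
    (h : readAfterTwo p p' ∈ I.histories [] M) : False := by
  have hp' := hp.symm
  obtain ⟨h', hs, hl⟩ := hI.exists_linearization h <| complete_of_forall_filter fun r => by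
    by_cases h₁ : p = r
    · subst h₁
      exact ⟨[(p, .inc, .ack), (p, .read, .val 1)], by simp [readAfterTwo, invres, hp']⟩
    · by_cases h₂ : p' = r
      · subst h₂
        exact ⟨[(p', .inc, .ack)], by simp [readAfterTwo, invres, hp]⟩
      · exact ⟨[], by simp [readAfterTwo, h₁, h₂]⟩
  obtain ⟨g, ⟨k, hg⟩, hv⟩ := exists_prefix_of_read (p := p) (n := 1) hs
    (hl.perm.subset (by simp [readAfterTwo]))
  have hnd : (readAfterTwo p p').Nodup := by simp [readAfterTwo, hp, hp']
  have hg' : h' = g ++ (p, .inv .read) :: ((p, .res (.val 1)) :: k) := by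
    rw [← hg]; simp [invres]
  -- Both `inc`s are forced before the `read`: that of `p` by process order, that of `p'` because
  -- its response precedes the invocation of the `read`, and its own invocation precedes that
  -- response.
  have hinc : (p, .inv .inc) ∈ g := hl.mem_of_order hnd
    (s₁ := [(p, .inv .inc), (p', .inv .inc), (p', .res .ack), (p, .res .ack)]) rfl
    (by simp) (.inl rfl) hg'
  have hres : (p', .res .ack) ∈ g := hl.mem_of_order hnd
    (s₁ := [(p, .inv .inc), (p', .inv .inc), (p', .res .ack), (p, .res .ack)]) rfl
    (by simp) (.inr ⟨⟨_, rfl⟩, ⟨_, rfl⟩⟩) hg'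
  obtain ⟨g₁, g₂, hg₁⟩ := List.append_of_mem hres
  have hinc' : (p', .inv .inc) ∈ g := by
    have := hl.mem_of_order hnd (s₁ := [(p, .inv .inc), (p', .inv .inc)]) (a := (p', .inv .inc))
      (g := g₁) (k := g₂ ++ (p, .inv .read) :: ((p, .res (.val 1)) :: k)) rfl
      (by simp) (.inl rfl) (by rw [hg', hg₁]; simp)
    rw [hg₁]
    exact List.mem_append_left _ this
  have hsub : List.Subperm [(p, .inv .inc), (p', .inv .inc)] g :=
    List.subperm_of_subset (by simp [hp]) (by simp [hinc, hinc'])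
  obtain ⟨l, hl₁, hl₂⟩ := hsub
  -- With no `dec` around, the two `inc`s push the value of `g` to at least `2`.
  have hnn : ∀ e ∈ g, 0 ≤ counterDelta e := fun e he => by
    have := hl.perm.symm.subset (hg' ▸ List.mem_append_left _ he)
    simp only [readAfterTwo, List.mem_cons, List.not_mem_nil, or_false] at this
    rcases this with rfl | rfl | rfl | rfl | rfl | rfl <;> simp [counterDelta]
  have h₁ : (l.map counterDelta).sum = 2 := by
    rw [(hl₁.map counterDelta).sum_eq]; simp [counterDelta]
  have h₂ := (hl₂.map counterDelta).sum_le_sum (List.forall_mem_map.mpr hnn)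
  unfold counterValue at hv
  omega

theorem Impl.Consistent.read_both_signs (hI : I.Consistent M) {p₁ p₂ p₃ : P} (h₁₂ : p₁ ≠ p₂)
    (h₁₃ : p₁ ≠ p₃) (h₂₃ : p₂ ≠ p₃)
    (h : readBothSigns p₁ p₂ p₃ ∈ I.histories [] M) : False := by
  have h₂₁ := h₁₂.symm
  have h₃₁ := h₁₃.symm
  have h₃₂ := h₂₃.symm
  obtain ⟨h', hs, hl⟩ := hI.exists_linearization h <| complete_of_forall_filter fun r => by
    by_cases h₁ : p₁ = r
    · subst h₁
      exact ⟨[(p₁, .inc, .ack), (p₁, .read, .val 1)], by simp [readBothSigns, invres, h₂₁, h₃₁]⟩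
    · by_cases h₂ : p₂ = r
      · subst h₂
        exact ⟨[(p₂, .dec, .ack)], by simp [readBothSigns, invres, h₁, h₃₂]⟩
      · by_cases h₃ : p₃ = r
        · subst h₃
          exact ⟨[(p₃, .read, .val (-1))], by simp [readBothSigns, invres, h₁, h₂]⟩
        · exact ⟨[], by simp [readBothSigns, h₁, h₂, h₃]⟩
  obtain ⟨g, hg, hv⟩ := exists_prefix_of_read (p := p₁) (n := 1) hs (hl.perm.subset (by simp [readBothSigns]))
  obtain ⟨g', hg', hv'⟩ := exists_prefix_of_read (p := p₃) (n := -1) hs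
    (hl.perm.subset (by simp [readBothSigns]))
  -- With one `inc` and one `dec` in total, no segment changes the value by more than `1`; the
  -- segment between the two reads would have to change it by `2`.
  have hsub {k : List (ObjEvent P CounterOp CounterRet)} (hk : k.Sublist h') :
      -1 ≤ counterValue k ∧ counterValue k ≤ 1 := by
    have hk' := hk.subperm.trans hl.perm.symm.subperm
    have h₁ := le_counterValue_of_subperm hk'
    have h₂ := counterValue_le_of_subperm hk'
    simp [readBothSigns, counterDelta] at h₁ h₂
    exact ⟨h₁, h₂⟩
  have hp : g <+: h' := (List.prefix_append _ _).trans hg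
  have hp' : g' <+: h' := (List.prefix_append _ _).trans hg'
  rcases List.prefix_or_prefix_of_prefix hp hp' with ⟨k, rfl⟩ | ⟨k, rfl⟩
  · have := (hsub ((List.sublist_append_right _ _).trans hp'.sublist)).1
    rw [counterValue_append] at hv'
    omega
  · have := (hsub ((List.sublist_append_right _ _).trans hp.sublist)).2
    rw [counterValue_append] at hv
    omega

theorem update_read_mem_spec (p p' : P) {o : CounterOp} {n : ℤ}
    (ho : o = .inc ∧ n = 1 ∨ o = .dec ∧ n = -1) {h : List (ObjEvent P CounterOp CounterRet)}
    (hh : h = invres p o .ack ++ invres p' .read (.val n)) : h ∈ (Counter P).Spec := by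
  refine ⟨?_, fun g r c u hg => ?_⟩
  · have := completeSequential_flatMap [(p, o, CounterRet.ack), (p', .read, CounterRet.val n)]
    simpa [hh] using this
  · subst hh
    rcases g with - | ⟨a, - | ⟨b, - | ⟨d, g⟩⟩⟩ <;>
      simp only [invres, List.nil_append, List.cons_append, List.cons_prefix_cons,
        Prod.mk.injEq, ObjAct.inv.injEq, ObjAct.res.injEq, reduceCtorEq, and_false,
        false_and] at hg
    · obtain ⟨⟨rfl, rfl⟩, ⟨-, rfl⟩, -⟩ := hg
      rcases ho with ⟨rfl, -⟩ | ⟨rfl, -⟩ <;> rfl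
    · obtain ⟨rfl, rfl, ⟨rfl, rfl⟩, ⟨-, rfl⟩, -⟩ := hg
      rcases ho with ⟨rfl, rfl⟩ | ⟨rfl, rfl⟩ <;> rfl
    · obtain ⟨-, -, -, hg⟩ := hg
      have := hg.length_le
      simp at this

/-- Under strict consistency, an `inc` followed by a `read` returns `1`, and a `dec` followed
by a `read` returns `-1`. -/
theorem Impl.SpecAvailable.exists_update_read [DecidableEq Var] [Zero Val]
    (hI : I.SpecAvailable) (p p' : P) {o : CounterOp} {n : ℤ}
    (ho : o = .inc ∧ n = 1 ∨ o = .dec ∧ n = -1) :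
    ∃ τ τ' m m', I.Runs o p τ .ack ∧ I.Runs CounterOp.read p' τ' (.val n) ∧
      Exec (fun _ => 0) τ m ∧ Exec m τ' m' :=
  hI.exists_runs (completeSequential_invres p o CounterRet.ack)
    (completeSequential_invres p' CounterOp.read (CounterRet.val n))
    (update_read_mem_spec p p' ho rfl)

end Counter

/-! ### Consequences of RBW and LTF. -/

section Patterns

variable {P : Type uP} {Var : Type uVar} {Val : Type uVal}

theorem RBW.of_append_right {σ σ' : List (MemEvent P Var Val)} (h : RBW (σ ++ σ')) : RBW σ' := by
  intro k₁ k₂ p₁ p₂ x y v w hk h₁ h₂ hxy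
  obtain ⟨k, p, u, hk₁, hk₂, hu⟩ := h (σ.length + k₁) (σ.length + k₂) p₁ p₂ x y v w (by omega)
    (by simpa [List.getElem?_append_right] using h₁)
    (by simpa [List.getElem?_append_right] using h₂) hxy
  refine ⟨k - σ.length, p, u, by omega, by omega, ?_⟩
  rwa [List.getElem?_append_right (by omega)] at hu

theorem RBW.tail {e : MemEvent P Var Val} {σ : List (MemEvent P Var Val)} (h : RBW (e :: σ)) :
    RBW σ := RBW.of_append_right (σ := [e]) h

/-- Only writes serve as the intermediate events that RBW demands, so deleting a non-write loses no
witness. This keeps the most recent write at the head of the list during an induction. -/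
theorem RBW.drop_second {e e' : MemEvent P Var Val} {σ : List (MemEvent P Var Val)}
    (h : RBW (e :: e' :: σ)) (he : ∀ x v, e'.2 ≠ .W x v) : RBW (e :: σ) := by
  intro k₁ k₂ p₁ p₂ x y v w hk h₁ h₂ hxy
  obtain ⟨k₂, rfl⟩ : ∃ k, k₂ = k + 1 := ⟨k₂ - 1, by omega⟩
  have key (k₁' : ℕ) (hk₁' : k₁' < k₂ + 2) (hle : k₁ = 0 ∨ k₁ + 1 ≤ k₁')
      (h₁' : (e :: e' :: σ)[k₁']? = some (p₁, .W x v)) :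
      ∃ (k : ℕ) (p : P) (u : Val), k₁ < k ∧ k < k₂ + 1 ∧ (e :: σ)[k]? = some (p, .W y u) := by
    obtain ⟨k, p, u, hk₁, hk₂, hu⟩ := h k₁' (k₂ + 2) p₁ p₂ x y v w hk₁' h₁' h₂ hxy
    rcases k with - | - | k
    · omega
    · simp only [zero_add, List.getElem?_cons_succ, List.getElem?_cons_zero,
        Option.some.injEq] at hu
      exact absurd (congrArg Prod.snd hu) (he y u)
    · exact ⟨k + 1, p, u, by omega, by omega, hu⟩
  rcases k₁ with - | k₁
  · exact key 0 (by omega) (.inl rfl) h₁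
  · exact key (k₁ + 2) (by omega) (.inr le_rfl) h₁

/-- The head `W x v` stands for the latest write, and agreement of the two memories at `x` is the
invariant. By RBW a read that comes next must be of `x`; a write to `y` makes the memories agree at
`y` instead. -/
theorem exists_exec_of_rbw [DecidableEq Var] {p : P} {x : Var} {v : Val}
    {τ : List (MemAct Var Val)} (hτ : RBW (byProc p (.W x v :: τ)))
    (hR : NoRMW τ) {m m' n : Var → Val} (hm : Exec m τ m') (hx : m x = n x) :
    ∃ n', Exec n τ n' := by
  induction τ generalizing x v m n with
  | nil => exact ⟨n, rfl⟩
  | cons a τ ih =>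
    cases a with
    | W y w => exact ih (x := y) hτ.tail hR.tail hm (by simp)
    | R y w =>
      have hxy : x = y := by
        by_contra hne
        obtain ⟨k, -, -, h₁, h₂, -⟩ := hτ 0 1 p p x y v w one_pos rfl rfl hne
        omega
      subst hxy
      obtain ⟨n', hn'⟩ := ih (hτ.drop_second (by simp)) hR.tail hm.2 hx
      exact ⟨n', hx ▸ hm.1, hn'⟩
    | RMW y w w' => exact absurd List.mem_cons_self (hR y w w')
    | F => exact ih (hτ.drop_second (by simp)) hR.tail hm hx

theorem exists_first_write {τ : List (MemAct Var Val)} (h : ∃ x v, MemAct.W x v ∈ τ) :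
    ∃ α β x v, τ = α ++ .W x v :: β ∧ ∀ y w, MemAct.W y w ∉ α := by
  induction τ with
  | nil => simp at h
  | cons a τ ih =>
    by_cases ha : ∃ x v, a = .W x v
    · obtain ⟨x, v, rfl⟩ := ha
      exact ⟨[], τ, x, v, rfl, by simp⟩
    · push Not at ha
      obtain ⟨x, v, hxv⟩ := h
      obtain ⟨α, β, y, w, rfl, hα⟩ := ih ⟨x, v,
        (List.mem_cons.mp hxv).resolve_left fun h => ha x v h.symm⟩
      refine ⟨a :: α, β, y, w, rfl, fun z u hm => ?_⟩
      exact (List.mem_cons.mp hm).elim (fun h => ha z u h.symm) (hα z u)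

theorem lf_decompose {p : P} {τ : List (MemAct Var Val)} (h : LF (byProc p τ)) :
    ∃ k n, τ = List.replicate k .F ++ n ∧ MemAct.F ∉ n := by
  induction τ with
  | nil => exact ⟨0, [], rfl, by simp⟩
  | cons a τ ih =>
    have hτ : LF (byProc p τ) := fun ⟨k, e, e', h₁, h₂, h₃⟩ => h ⟨k + 1, e, e', h₁, h₂, h₃⟩
    obtain ⟨k, n, rfl, hn⟩ := ih hτ
    by_cases ha : a = .F
    · subst ha
      exact ⟨k + 1, n, rfl, hn⟩
    · cases k with
      | zero => exact ⟨0, a :: n, rfl, by simpa [hn] using Ne.symm ha⟩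
      | succ k => exact absurd ⟨0, (p, a), (p, .F), rfl, rfl, ha, rfl⟩ h

theorem tf_decompose {p : P} {τ : List (MemAct Var Val)} (h : TF (byProc p τ)) :
    ∃ n k, τ = n ++ List.replicate k .F ∧ MemAct.F ∉ n := by
  induction τ with
  | nil => exact ⟨[], 0, rfl, by simp⟩
  | cons a τ ih =>
    have hτ : TF (byProc p τ) := fun ⟨k, e, e', h₁, h₂, h₃⟩ => h ⟨k + 1, e, e', h₁, h₂, h₃⟩
    obtain ⟨n, k, rfl, hn⟩ := ih hτ
    by_cases ha : a = .F
    · subst ha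
      cases n with
      | nil => exact ⟨[], k + 1, rfl, by simp⟩
      | cons b n =>
        exact absurd ⟨0, (p, .F), (p, b), rfl, rfl, rfl, fun hb => hn (by
          rw [show b = MemAct.F from hb]; exact List.mem_cons_self)⟩ h
    · exact ⟨a :: n, k, rfl, by simpa [hn] using Ne.symm ha⟩

/-- The LF part has its fences at the front and the TF part has them at the back, so the two
fence-free pieces meet in the middle. -/
theorem ltf_decompose {p : P} {τ : List (MemAct Var Val)} (h : LTF (byProc p τ)) :
    ∃ k n l, τ = List.replicate k .F ++ (n ++ List.replicate l .F) ∧ MemAct.F ∉ n := by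
  obtain ⟨σ₁, σ₂, hσ, h₁, h₂⟩ := h
  obtain ⟨τ₁, τ₂, rfl, rfl, rfl⟩ := List.map_eq_append_iff.mp hσ
  obtain ⟨k, n₁, rfl, hn₁⟩ := lf_decompose h₁
  obtain ⟨n₂, l, rfl, hn₂⟩ := tf_decompose h₂
  exact ⟨k, n₁ ++ n₂, l, by simp, by simp [hn₁, hn₂]⟩

end Patterns

/-! ### The strictly consistent case. -/

variable {P : Type uP} [DecidableEq P] {Var : Type uVar} {Val : Type uVal}
variable {I : Impl.{uP, uVar, uVal, 0, 0, uS} Var Val (Counter P)}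

theorem Impl.SpecAvailable.rmw_or_not_rbw [DecidableEq Var] [Zero Val] (hI : I.SpecAvailable)
    (hc : I.Consistent (SCM P Var Val)) {p p' : P} (hp : p ≠ p') :
    ∃ π₁ ∈ (I CounterOp.inc p).lts.traces, ∃ π₂ ∈ (I CounterOp.read p).lts.traces,
      HasRMW (restrictMem π₁ ++ restrictMem π₂) ∨ ¬ RBW (restrictMem π₁ ++ restrictMem π₂) := by
  obtain ⟨τ, τ₂, m, m', hτ, hτ₂, hm, hm'⟩ := hI.exists_update_read p p (.inl ⟨rfl, rfl⟩)
  obtain ⟨τ', -, m₁, -, hτ', -, hm₁, -⟩ := hI.exists_update_read p' p (.inl ⟨rfl, rfl⟩)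
  refine ⟨_, hτ.mem_traces, _, hτ₂.mem_traces, ?_⟩
  by_contra! hcon
  simp only [restrictMem_memEvents, ← byProc_append] at hcon
  obtain ⟨hR, hW⟩ := hcon
  replace hR := noRMW_of_not_hasRMW hR
  by_cases hw : ∃ x v, MemAct.W x v ∈ τ
  · obtain ⟨α, β, x, v, rfl, hα⟩ := exists_first_write hw
    rw [List.append_assoc] at hR hW
    obtain ⟨n, hn, hβ⟩ := exec_append.mp hm
    obtain rfl := hn.eq_of_no_write hR.of_append.1 hα
    rw [byProc_append, List.cons_append] at hW
    -- The suffix starting with the first write of `p` is replayed on the memory `m₁` left by the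
    -- `inc` of `p'`; right after that write both memories hold `v` at `x`.
    obtain ⟨n', hn'⟩ := exists_exec_of_rbw hW.of_append_right hR.of_append.2.tail
      (exec_append.mpr ⟨m, hβ, hm'⟩) (n := Function.update m₁ x v) (by simp)
    obtain ⟨n₁, hn₁, hn₂⟩ := exec_append.mp hn'
    refine hc.read_after_two hp (nested_mem_histories hp hτ hτ₂ hτ' (μ := n') ?_)
    exact (((SCM.run_iff_exec.mpr hn).append (SCM.run_iff_exec.mpr hm₁)).append
      (SCM.run_iff_exec (τ := .W x v :: β).mpr hn₁)).append (SCM.run_iff_exec.mpr hn₂)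
  · push Not at hw
    obtain rfl := hm.eq_of_no_write hR.of_append.1 hw
    exact hc.read_alone (hτ₂.mem_histories (SCM.run_iff_exec.mpr hm'))

/-! ### Solo runs under total store order. -/

section TSOSimulation

variable {P : Type uP} [DecidableEq P] {Var : Type uVar} {Val : Type uVal} [DecidableEq Var]

/-- The memory after all entries of a buffer have reached it. -/
def TSO.flush (m : Var → Val) (β : List (Var × Val)) : Var → Val :=
  β.foldl (fun m w => Function.update m w.1 w.2) m

theorem TSO.flush_append (m : Var → Val) (β β' : List (Var × Val)) :
    TSO.flush m (β ++ β') = TSO.flush (TSO.flush m β) β' := List.foldl_append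

/-- A process reads exactly the value that its variable would have once its buffer has been flushed.
Hence the flushed memory plays the role of the strictly consistent one. -/
theorem TSO.lookup_flush (m : Var → Val) (β : List (Var × Val)) (x : Var) :
    (β.filter (fun w => w.1 = x)).getLast? = some (x, TSO.flush m β x) ∨
      β.filter (fun w => w.1 = x) = [] ∧ m x = TSO.flush m β x := by
  induction β using List.reverseRecOn with
  | nil => exact .inr ⟨rfl, rfl⟩
  | append_singleton β w ih =>
    obtain ⟨y, w⟩ := w
    rw [List.filter_append, TSO.flush_append]
    by_cases hy : y = x
    · subst hy
      exact .inl (by simp [TSO.flush])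
    · simpa [TSO.flush, hy, Function.update_of_ne (Ne.symm hy)] using ih

variable [Zero Val]

theorem TSO.run_flush (m : Var → Val) (b : P → List (Var × Val)) (p : P) :
    (TSO P Var Val).Run ⟨m, b⟩ [] ⟨TSO.flush m (b p), Function.update b p []⟩ := by
  generalize hβ : b p = β
  induction β generalizing m b with
  | nil => rw [← hβ, Function.update_eq_self, hβ]; exact .nil _
  | cons w β ih =>
    have h := ih (Function.update m w.1 w.2) (Function.update b p β) (Function.update_self ..)
    rw [Function.update_idem] at h
    exact (MemoryModel.Run.silent (TSO.Tr.propagate m b p w.1 w.2 β hβ)).append h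

theorem TSO.run_fences {m : Var → Val} {b : P → List (Var × Val)} {p : P} (hp : b p = [])
    (k : ℕ) : (TSO P Var Val).Run ⟨m, b⟩ (byProc p (List.replicate k .F)) ⟨m, b⟩ := by
  induction k with
  | zero => exact .nil _
  | succ k ih => exact (MemoryModel.Run.event (TSO.Tr.fence m b p hp)).append ih

/-- A single process can run under total store order as under strict consistency,
without changing the memory if there are no fences. -/
theorem TSO.exists_run {p : P} {τ : List (MemAct Var Val)} (hR : NoRMW τ) {m m' : Var → Val}
    {b : P → List (Var × Val)} (h : Exec (TSO.flush m (b p)) τ m') :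
    ∃ n β, (TSO P Var Val).Run ⟨m, b⟩ (byProc p τ) ⟨n, Function.update b p β⟩ ∧
      TSO.flush n β = m' ∧ (MemAct.F ∉ τ → n = m) := by
  induction τ generalizing m b with
  | nil =>
    refine ⟨m, b p, ?_, h, fun _ => rfl⟩
    rw [Function.update_eq_self]
    exact .nil _
  | cons a τ ih =>
    cases a with
    | W x v =>
      obtain ⟨n, β, hn, hβ, hF⟩ := ih hR.tail (m := m)
        (b := Function.update b p (b p ++ [(x, v)]))
        (by rw [Function.update_self, TSO.flush_append]; exact h)
      rw [Function.update_idem] at hn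
      exact ⟨n, β, (MemoryModel.Run.event (TSO.Tr.write m b p x v)).append hn, hβ,
        fun hF' => hF fun hm => hF' (List.mem_cons_of_mem _ hm)⟩
    | R x v =>
      obtain ⟨rfl, h⟩ := h
      obtain ⟨n, β, hn, hβ, hF⟩ := ih hR.tail h
      have hr : (TSO P Var Val).Tr ⟨m, b⟩ (some (p, .R x (TSO.flush m (b p) x))) ⟨m, b⟩ := by
        rcases TSO.lookup_flush m (b p) x with h | ⟨h₁, h₂⟩
        · exact TSO.Tr.readFromBuffer m b p x _ h
        · exact TSO.Tr.readFromMemory m b p x _ h₁ h₂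
      exact ⟨n, β, (MemoryModel.Run.event hr).append hn, hβ,
        fun hF' => hF fun hm => hF' (List.mem_cons_of_mem _ hm)⟩
    | RMW x v w => exact absurd List.mem_cons_self (hR x v w)
    | F =>
      -- The buffer is emptied into memory to enable the fence; the flushed view of `p` does not
      -- change.
      obtain ⟨n, β, hn, hβ, -⟩ := ih hR.tail (m := TSO.flush m (b p))
        (b := Function.update b p []) (by rw [Function.update_self]; exact h)
      rw [Function.update_idem] at hn
      exact ⟨n, β, (TSO.run_flush m b p).append ((MemoryModel.Run.event
        (TSO.Tr.fence _ _ p (Function.update_self ..))).append hn), hβ,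
        fun hF => absurd List.mem_cons_self hF⟩

end TSOSimulation

/-! ### The total store order case. -/

section Main

variable {P : Type uP} [DecidableEq P] {Var : Type uVar} {Val : Type uVal}
variable {I : Impl.{uP, uVar, uVal, 0, 0, uS} Var Val (Counter P)}
variable [DecidableEq Var] [Zero Val]

/-- Fences can only lead in an `inc` whose concatenation with a later `read` is LTF. -/
theorem Impl.SpecAvailable.exists_leading_fences (hI : I.SpecAvailable)
    (hc : I.Consistent (TSO P Var Val)) (p : P)
    (hltf : ∀ π₁ ∈ (I CounterOp.inc p).lts.traces, ∀ π₂ ∈ (I CounterOp.read p).lts.traces,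
      ¬ HasRMW (restrictMem π₁ ++ restrictMem π₂) ∧ LTF (restrictMem π₁ ++ restrictMem π₂)) :
    ∃ k n τ m m', I.Runs CounterOp.inc p (List.replicate k .F ++ n) .ack ∧
      I.Runs CounterOp.read p τ (.val 1) ∧ Exec (fun _ => 0) n m ∧ Exec m τ m' ∧
      MemAct.F ∉ n ∧ NoRMW n ∧ NoRMW τ := by
  obtain ⟨τ, τ₂, m, m', hτ, hτ₂, hm, hm'⟩ := hI.exists_update_read p p (.inl ⟨rfl, rfl⟩)
  obtain ⟨hR, hF⟩ := hltf _ hτ.mem_traces _ hτ₂.mem_traces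
  simp only [restrictMem_memEvents, ← byProc_append] at hR hF
  replace hR := noRMW_of_not_hasRMW hR
  -- If the `read` could run from the initial memory, it would return `1` with no `inc` invoked.
  have hno {m₂ : Var → Val} (h : Exec (fun _ => 0) τ₂ m₂) : False := by
    obtain ⟨n, β, hn, -⟩ := TSO.exists_run (p := p) (b := fun _ => []) hR.of_append.2 h
    exact hc.read_alone (hτ₂.mem_histories hn)
  obtain ⟨k, n, l, heq, hn⟩ := ltf_decompose hF
  -- Where the boundary between `inc` and `read` falls: inside the leading fences the `inc` does
  -- nothing, inside the trailing fences the `read` reads nothing. Both contradict `hno`, which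
  -- leaves the fence-free middle.
  rcases List.append_eq_append_iff.mp heq with ⟨a, ha, -⟩ | ⟨c, rfl, hc'⟩
  · obtain ⟨-, hrep, -⟩ := List.append_eq_replicate_iff.mp ha.symm
    rw [hrep, exec_replicate_fence] at hm
    exact (hno (hm ▸ hm')).elim
  · rcases List.append_eq_append_iff.mp hc' with ⟨a, -, ha⟩ | ⟨d, rfl, -⟩
    · obtain ⟨-, -, hrep⟩ := List.append_eq_replicate_iff.mp ha.symm
      rw [hrep] at hno
      exact (hno (exec_replicate_fence.mpr rfl)).elim
    · obtain ⟨n₁, hn₁, hm⟩ := exec_append.mp hm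
      rw [exec_replicate_fence] at hn₁
      subst hn₁
      exact ⟨k, _, τ₂, m, m', hτ, hτ₂, hm, hm', fun h => hn (by simp [h]),
        hR.of_append.1.of_append.2, hR.of_append.2⟩

/-- The process `r` is not known in advance: the `inc`s of both `p` and `p'` must stay buffered, so
the pattern may fail at either of them. -/
theorem Impl.SpecAvailable.rmw_or_not_ltf_of_tso (hI : I.SpecAvailable)
    (hc : I.Consistent (TSO P Var Val)) {p p' : P} (hp : p ≠ p') :
    ∃ r, ∃ π₁ ∈ (I CounterOp.inc r).lts.traces, ∃ π₂ ∈ (I CounterOp.read r).lts.traces,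
      HasRMW (restrictMem π₁ ++ restrictMem π₂) ∨ ¬ LTF (restrictMem π₁ ++ restrictMem π₂) := by
  by_contra! hcon
  obtain ⟨k, n, τ, m, m', hn, hτ, hm, hm', hF, hR, hRτ⟩ :=
    hI.exists_leading_fences hc p (hcon p)
  obtain ⟨k', n', -, m₁, -, hn', -, hm₁, -, hF', hR', -⟩ :=
    hI.exists_leading_fences hc p' (hcon p')
  obtain ⟨_, β, h₁, rfl, heq⟩ := TSO.exists_run (p := p) (b := fun _ => []) hR hm
  obtain rfl := heq hF
  obtain ⟨_, β', h₂, -, heq⟩ := TSO.exists_run (p := p') (m := fun _ => 0)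
    (b := Function.update (fun _ => []) p β) hR'
    (by rw [Function.update_of_ne hp.symm]; exact hm₁)
  obtain rfl := heq hF'
  -- Memory is still initial and `p` has its own writes buffered, so its flushed view is the memory
  -- from which its solo `read` returned `1`. Fences in the `read` may flush this buffer without
  -- harm.
  obtain ⟨_, _, h₃, -⟩ := TSO.exists_run (p := p) (m := fun _ => 0)
    (b := Function.update (Function.update (fun _ => []) p β) p' β') hRτ
    (by rw [Function.update_of_ne hp, Function.update_self]; exact hm')
  have hrun : (TSO P Var Val).Run (TSO P Var Val).init _ _ :=
    ((((TSO.run_fences (p := p) rfl k).append h₁).append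
      ((TSO.run_fences (Function.update_of_ne hp.symm ..) k').append h₂)).append (.nil _)).append h₃
  refine hc.read_after_two hp (nested_mem_histories hp (β := []) (by simpa using hn) hτ hn'
    (by simpa using hrun))

end Main

/-! ### Solo runs under release/acquire. -/

section RASimulation

variable {P : Type uP} {Var : Type uVar} {Val : Type uVal}

/-- At its view, the process `p` sees the memory `m`. -/
def RA.Sees (S : RA.St P Var Val) (p : P) (m : Var → Val) : Prop :=
  ∀ x, ∃ V, (⟨x, m x, S.pview p x, V⟩ : RA.Msg Var Val) ∈ S.mem

/-- The timestamps of the messages to a variable are bounded. -/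
def RA.TimeBounded (M : Set (RA.Msg Var Val)) : Prop :=
  ∀ x, ∃ b, ∀ μ ∈ M, μ.var = x → μ.time ≤ b

theorem RA.TimeBounded.insert {M : Set (RA.Msg Var Val)} (h : RA.TimeBounded M)
    (μ : RA.Msg Var Val) : RA.TimeBounded (M ∪ {μ}) := by
  intro x
  obtain ⟨b, hb⟩ := h x
  refine ⟨max b μ.time, ?_⟩
  rintro ν (hν | rfl) hx
  · exact (hb ν hν hx).trans (le_max_left _ _)
  · exact le_max_right _ _

/-- The effect of a run of `p` alone. -/
structure RA.Extends (p : P) (S S' : RA.St P Var Val) : Prop where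
  mem_subset : S.mem ⊆ S'.mem
  pview_eq : ∀ r, r ≠ p → S'.pview r = S.pview r
  pview_le : S.pview p ≤ S'.pview p
  fview_le : S.fview ≤ S.pview p → S'.fview ≤ S'.pview p
  acquirable : S'.pview p = S.pview p ∨
    ∃ μ ∈ S'.mem, μ.view = S'.pview p ∧ S.pview p μ.var < μ.time

theorem RA.Extends.refl (p : P) (S : RA.St P Var Val) : RA.Extends p S S :=
  ⟨subset_rfl, fun _ _ => rfl, le_rfl, id, .inl rfl⟩

/-- For `acquirable`, the later fragment decides: if it moved the view, its message already carries
the final view; if not, the message of the earlier fragment still does. -/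
theorem RA.Extends.trans {p : P} {S S' S'' : RA.St P Var Val} (h : RA.Extends p S S')
    (h' : RA.Extends p S' S'') : RA.Extends p S S'' where
  mem_subset := h.mem_subset.trans h'.mem_subset
  pview_eq r hr := (h'.pview_eq r hr).trans (h.pview_eq r hr)
  pview_le := h.pview_le.trans h'.pview_le
  fview_le := h'.fview_le ∘ h.fview_le
  acquirable := by
    rcases h'.acquirable with heq | ⟨μ, hμ, hv, ht⟩
    · rw [heq]
      exact h.acquirable.imp_right fun ⟨μ, hμ, h⟩ => ⟨μ, h'.mem_subset hμ, h⟩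
    · exact .inr ⟨μ, hμ, hv, (h.pview_le _).trans_lt ht⟩

variable [DecidableEq P] [DecidableEq Var] [Zero Val]

/-- Fences are no-ops while the view of `p` equals the fence view; this disposes of leading fences
executed in the initial state. -/
theorem RA.run_fences_of_eq {S : RA.St P Var Val} {p : P} (h : S.fview = S.pview p) (k : ℕ) :
    (RA P Var Val).Run S (byProc p (List.replicate k .F)) S := by
  induction k with
  | zero => exact .nil _
  | succ k ih =>
    have ht := RA.Tr.fence S.mem S.pview S.fview p S.fview (by rw [← h, sup_idem])
    rw [show Function.update S.pview p S.fview = S.pview by rw [h, Function.update_eq_self]] at ht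
    exact (MemoryModel.Run.event (M := RA P Var Val) ht).append ih

theorem RA.exists_run_fences (S : RA.St P Var Val) (p : P) (k : ℕ) :
    ∃ S', (RA P Var Val).Run S (byProc p (List.replicate k .F)) S' := by
  induction k generalizing S with
  | zero => exact ⟨S, .nil _⟩
  | succ k ih =>
    obtain ⟨S', hS'⟩ := ih _
    exact ⟨S', (MemoryModel.Run.event (M := RA P Var Val)
      (RA.Tr.fence S.mem S.pview S.fview p _ rfl)).append hS'⟩

/-- A single process can run under release/acquire as under strict consistency. -/
theorem RA.exists_run {p : P} {τ : List (MemAct Var Val)} (hR : NoRMW τ) {m m' : Var → Val}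
    {S : RA.St P Var Val} (hS : RA.Sees S p m) (hb : RA.TimeBounded S.mem)
    (hF : MemAct.F ∈ τ → S.fview ≤ S.pview p) (h : Exec m τ m') :
    ∃ S', (RA P Var Val).Run S (byProc p τ) S' ∧ RA.Extends p S S' ∧ RA.Sees S' p m' ∧
      RA.TimeBounded S'.mem ∧ (MemAct.F ∉ τ → S'.fview = S.fview) := by
  induction τ generalizing m S with
  | nil => exact ⟨S, .nil _, .refl p S, h ▸ hS, hb, fun _ => rfl⟩
  | cons a τ ih =>
    cases a with
    | W x v =>
      obtain ⟨b, hbx⟩ := hb x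
      -- This timestamp exceeds both the view of `p` and every timestamp used for `x`, so it is
      -- fresh whatever other processes have written.
      have hlt : S.pview p x < max b (S.pview p x) + 1 := by omega
      have hle : S.pview p ≤ Function.update (S.pview p) x (max b (S.pview p x) + 1) := by
        intro y
        by_cases hy : y = x
        · subst hy; simpa using hlt.le
        · simp [hy]
      have ht := RA.Tr.write S.mem S.pview S.fview p x v (max b (S.pview p x) + 1) _ hlt
        (fun ⟨μ, hμ, hx, ht⟩ => by have := hbx μ hμ hx; omega) rfl
      set V := Function.update (S.pview p) x (max b (S.pview p x) + 1) with hV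
      have he : RA.Extends p S ⟨S.mem ∪ {⟨x, v, max b (S.pview p x) + 1, V⟩},
          Function.update S.pview p V, S.fview⟩ :=
        ⟨Set.subset_union_left, fun r hr => Function.update_of_ne hr .., by simpa using hle,
          fun hf => by simpa using hf.trans hle,
          .inr ⟨_, .inr rfl, (Function.update_self (f := S.pview) ..).symm, hlt⟩⟩
      obtain ⟨S', hrun, he', hs, hb', hf⟩ := ih hR.tail (S := ⟨_, _, _⟩)
        (m := Function.update m x v) (fun y => by
          by_cases hy : y = x
          · subst hy
            exact ⟨V, .inr (by simp [hV])⟩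
          · obtain ⟨W, hW⟩ := hS y
            exact ⟨W, .inl (by simpa [hV, hy] using hW)⟩)
        (hb.insert _) (fun hm => he.fview_le (hF (List.mem_cons_of_mem _ hm))) h
      exact ⟨S', (MemoryModel.Run.event (M := RA P Var Val) ht).append hrun, he.trans he', hs,
        hb', fun hF' => hf fun hm => hF' (List.mem_cons_of_mem _ hm)⟩
    | R x v =>
      obtain ⟨rfl, h⟩ := h
      obtain ⟨V, hV⟩ := hS x
      obtain ⟨S', hrun, he, hs, hb', hf⟩ :=
        ih hR.tail hS hb (fun hm => hF (List.mem_cons_of_mem _ hm)) h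
      exact ⟨S', (MemoryModel.Run.event (M := RA P Var Val)
        (RA.Tr.read S.mem S.pview S.fview p x _ V hV)).append hrun, he, hs, hb',
        fun hF' => hf fun hm => hF' (List.mem_cons_of_mem _ hm)⟩
    | RMW x v w => exact absurd List.mem_cons_self (hR x v w)
    | F =>
      have hle := hF List.mem_cons_self
      -- As the fence view lies below the view of `p`, the fence imports nothing from other
      -- processes and only raises the fence view.
      have ht := RA.Tr.fence S.mem S.pview S.fview p (S.pview p) (sup_eq_left.mpr hle).symm
      rw [Function.update_eq_self] at ht
      obtain ⟨S', hrun, he, hs, hb', -⟩ :=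
        ih hR.tail (S := ⟨S.mem, S.pview, S.pview p⟩) hS hb (fun _ => le_rfl) h
      exact ⟨S', (MemoryModel.Run.event (M := RA P Var Val) ht).append hrun,
        ⟨he.mem_subset, he.pview_eq, he.pview_le, fun _ => he.fview_le le_rfl, he.acquirable⟩,
        hs, hb', fun hF' => absurd List.mem_cons_self hF'⟩

end RASimulation

/-! ### The release/acquire case. -/

section Main

variable {P : Type uP} [DecidableEq P] {Var : Type uVar} {Val : Type uVal}
variable {I : Impl.{uP, uVar, uVal, 0, 0, uS} Var Val (Counter P)}
variable [DecidableEq Var] [Zero Val]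

theorem Impl.SpecAvailable.rmw_or_not_ltf_of_ra (hI : I.SpecAvailable)
    (hc : I.Consistent (RA P Var Val)) {p₁ p₂ p₃ : P} (h₁₂ : p₁ ≠ p₂) (h₁₃ : p₁ ≠ p₃)
    (h₂₃ : p₂ ≠ p₃) :
    ∃ (p p' : P) (o : CounterOp), (o = .inc ∨ o = .dec) ∧
      ∃ π₁ ∈ (I o p).lts.traces, ∃ π₂ ∈ (I CounterOp.read p').lts.traces,
        (HasRMW (restrictMem π₁) ∨ HasRMW (restrictMem π₂)) ∨
        (¬ LTF (restrictMem π₁) ∨ ¬ LTF (restrictMem π₂)) := by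
  by_contra! hcon
  obtain ⟨τ, τ', m₁, m₁', hτ, hτ', hm₁, hm₁'⟩ := hI.exists_update_read p₁ p₁ (.inl ⟨rfl, rfl⟩)
  obtain ⟨τ₂, τ₃, m, m', hτ₂, hτ₃, hm, hm'⟩ := hI.exists_update_read p₂ p₃ (.inr ⟨rfl, rfl⟩)
  obtain ⟨⟨hR, hR'⟩, -⟩ :=
    hcon p₁ p₁ _ (.inl rfl) _ hτ.mem_traces _ hτ'.mem_traces
  obtain ⟨⟨hR₂, hR₃⟩, hF₂, hF₃⟩ :=
    hcon p₂ p₃ _ (.inr rfl) _ hτ₂.mem_traces _ hτ₃.mem_traces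
  simp only [restrictMem_memEvents] at hR hR' hR₂ hR₃ hF₂ hF₃
  replace hR := noRMW_of_not_hasRMW hR
  replace hR' := noRMW_of_not_hasRMW hR'
  replace hR₂ := noRMW_of_not_hasRMW hR₂
  replace hR₃ := noRMW_of_not_hasRMW hR₃
  obtain ⟨k₂, n₂, l₂, rfl, hn₂⟩ := ltf_decompose hF₂
  obtain ⟨k₃, n₃, l₃, rfl, hn₃⟩ := ltf_decompose hF₃
  simp only [exec_append, exec_replicate_fence, exists_eq_left', exists_eq_right] at hm hm'
  have hRR : NoRMW (τ ++ τ') := fun x v w h =>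
    (List.mem_append.mp h).elim (hR x v w) (hR' x v w)
  have hinit : RA.Sees (RA P Var Val).init p₂ fun _ => 0 := fun x => ⟨_, x, rfl⟩
  -- Only the fence-free middle of the `dec` runs here, so the fence view stays `0` and fences of
  -- `p₁` learn nothing about the `dec`.
  obtain ⟨S₁, hrun₁, he₁, hs₁, hb₁, hf₁⟩ := RA.exists_run hR₂.of_append.2.of_append.1 hinit
    (fun x => ⟨0, by rintro _ ⟨y, rfl⟩ -; exact le_rfl⟩) (fun h => absurd h hn₂) hm
  replace hf₁ := hf₁ hn₂
  have hsee : RA.Sees S₁ p₁ fun _ => 0 := fun x =>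
    ⟨fun _ => 0, by rw [he₁.pview_eq p₁ h₁₂]; exact he₁.mem_subset ⟨x, rfl⟩⟩
  obtain ⟨S₂, hrun₂, he₂, -, hb₂, -⟩ := RA.exists_run hRR hsee hb₁
    (fun _ => by rw [hf₁, he₁.pview_eq p₁ h₁₂]; exact le_rfl) (exec_append.mpr ⟨m₁, hm₁, hm₁'⟩)
  have hp₃ : S₂.pview p₃ = fun _ => 0 :=
    (he₂.pview_eq p₃ h₁₃.symm).trans (he₁.pview_eq p₃ h₂₃.symm)
  -- The view of `p₃` is still `0`, so joining it with the view of the last message of `p₂` gives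
  -- exactly the view of `p₂`; if `p₂` wrote nothing, the two views already agree. Later messages of
  -- `p₁` remain unseen.
  obtain ⟨S₃, hrun₃, hmem₃, hv₃⟩ : ∃ S₃, (RA P Var Val).Run S₂ [] S₃ ∧ S₃.mem = S₂.mem ∧
      S₃.pview p₃ = S₁.pview p₂ := by
    rcases he₁.acquirable with heq | ⟨μ, hμ, hv, ht⟩
    · exact ⟨S₂, .nil _, rfl, hp₃.trans heq.symm⟩
    · refine ⟨_, .silent (M := RA P Var Val) (RA.Tr.propagate S₂.mem S₂.pview S₂.fview p₃ μ
        (he₂.mem_subset hμ) (by rw [hp₃]; exact ht)), rfl, ?_⟩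
      rw [hp₃, ← hv]
      funext x
      simp
  -- The fence view may by now contain writes of `p₁`, but `n₃` has no fence through which they
  -- could reach `p₃`.
  obtain ⟨S₄, hrun₄, -⟩ := RA.exists_run (p := p₃) (S := S₃) hR₃.of_append.2.of_append.1
    (fun x => by
      obtain ⟨V, hV⟩ := hs₁ x
      exact ⟨V, by rw [hmem₃, hv₃]; exact he₂.mem_subset hV⟩)
    (hmem₃ ▸ hb₂) (fun h => absurd h hn₃) hm'
  -- Fences are always enabled, and no read follows the trailing ones, so their effect on views is
  -- irrelevant.
  obtain ⟨S₅, hrun₅⟩ := RA.exists_run_fences S₄ p₃ l₃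
  obtain ⟨S₆, hrun₆⟩ := RA.exists_run_fences S₅ p₂ l₂
  have hrun := ((RA.run_fences_of_eq (S := (RA P Var Val).init) (p := p₃) rfl k₃).append
    ((RA.run_fences_of_eq (p := p₂) rfl k₂).append hrun₁)).append
    (hrun₂.append (hrun₃.append (hrun₄.append (hrun₅.append hrun₆))))
  refine hc.read_both_signs h₁₂ h₁₃ h₂₃ (overlapping_mem_histories h₁₂ h₁₃ h₂₃ hτ hτ'
    (β := List.replicate k₂ .F ++ n₂) (β' := List.replicate l₂ .F) (by simpa using hτ₂) hτ₃
    (μ := S₆) ?_)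
  simpa using hrun

end Main

end WeakMem

theorem mainTheorem5 {N : ℕ} {Var Val : Type*} [DecidableEq Var] [Zero Val]
    (I : WeakMem.Impl Var Val (WeakMem.Counter (Fin N))) (hI : I.SpecAvailable) :
    (2 ≤ N → I.Consistent (WeakMem.SCM (Fin N) Var Val) →
      ∃ (p p' : Fin N) (o : WeakMem.CounterOp),
        (o = .inc ∨ o = .dec) ∧
        ∃ π₁ ∈ (I o p).lts.traces, ∃ π₂ ∈ (I .read p').lts.traces,
          WeakMem.HasRMW (WeakMem.restrictMem π₁ ++ WeakMem.restrictMem π₂) ∨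
          ¬ WeakMem.RBW (WeakMem.restrictMem π₁ ++ WeakMem.restrictMem π₂)) ∧
    (2 ≤ N → I.Consistent (WeakMem.TSO (Fin N) Var Val) →
      ∃ (p p' : Fin N) (o : WeakMem.CounterOp),
        (o = .inc ∨ o = .dec) ∧
        ∃ π₁ ∈ (I o p).lts.traces, ∃ π₂ ∈ (I .read p').lts.traces,
          WeakMem.HasRMW (WeakMem.restrictMem π₁ ++ WeakMem.restrictMem π₂) ∨
          ¬ WeakMem.LTF (WeakMem.restrictMem π₁ ++ WeakMem.restrictMem π₂)) ∧
    (3 ≤ N → I.Consistent (WeakMem.RA (Fin N) Var Val) →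
      ∃ (p p' : Fin N) (o : WeakMem.CounterOp),
        (o = .inc ∨ o = .dec) ∧
        ∃ π₁ ∈ (I o p).lts.traces, ∃ π₂ ∈ (I .read p').lts.traces,
          (WeakMem.HasRMW (WeakMem.restrictMem π₁) ∨ WeakMem.HasRMW (WeakMem.restrictMem π₂)) ∨
          (¬ WeakMem.LTF (WeakMem.restrictMem π₁) ∨ ¬ WeakMem.LTF (WeakMem.restrictMem π₂))) := by
  refine ⟨fun hN hc => ?_, fun hN hc => ?_, fun hN hc => ?_⟩
  · have hne : (⟨0, by omega⟩ : Fin N) ≠ ⟨1, by omega⟩ := by simp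
    exact ⟨_, _, .inc, .inl rfl, hI.rmw_or_not_rbw hc hne⟩
  · have hne : (⟨0, by omega⟩ : Fin N) ≠ ⟨1, by omega⟩ := by simp
    obtain ⟨r, h⟩ := hI.rmw_or_not_ltf_of_tso hc hne
    exact ⟨r, r, .inc, .inl rfl, h⟩
  · have h₁₂ : (⟨0, by omega⟩ : Fin N) ≠ ⟨1, by omega⟩ := by simp
    have h₁₃ : (⟨0, by omega⟩ : Fin N) ≠ ⟨2, by omega⟩ := by simp
    have h₂₃ : (⟨1, by omega⟩ : Fin N) ≠ ⟨2, by omega⟩ := by simp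
    exact hI.rmw_or_not_ltf_of_ra hc h₁₂ h₁₃ h₂₃
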